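/- **Conventions.** $C^*$-algebras are complex and need not be unital. A $C^*$-dynamical system $(A,\varphi_t)$ is a $C^*$-algebra $A$ with a group homomorphism $t\mapsto\varphi_t$ from $\mathbb R$ into the $*$-automorphisms of $A$ such that $t\mapsto\varphi_t(a)$ is norm continuous for every $a\in A$. Let $\beta>0$. A KMS$_\beta$ state for $(A,\varphi_t)$ is a bounded linear functional $\omega:A\to\mathbb C$ such that $\omega(a^*a)\ge 0$ for all $a\in A$, $\|\omega\|=1$, and for all $a,b\in A$ there is a function $F_{ab}$, holomorphic on the open strip $\{z\in\mathbb C: 0<\operatorname{Im}z<\beta\}$ and continuous on the closed strip $\{0\le\operatorname{Im}z\le\beta\}$, with $$F_{ab}(t)=\omega(a\,\varphi_t(b)),\qquad F_{ab}(t+i\beta)=\omega(\varphi_t(b)\,a)\qquad(t\in\mathbb R).$$ Given faithful $*$-representations $\pi_A$, $\pi_B$ of $C^*$-algebras $A$, $B$ on Hilbert spaces $\mathcal H_A$, $\mathcal H_B$, the injective (spatial) tensor product $A\hat\otimes_\epsilon B$ is the completion of the algebraic tensor product $A\otimes B$ in the norm $\|\sum_i a_i\otimes b_i\|_\epsilon=\|\sum_i\pi_A(a_i)\otimes\pi_B(b_i)\|$,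 i.e. the norm closure of $(\pi_A\otimes\pi_B)(A\otimes B)$ in the bounded operators on the Hilbert space tensor product of $\mathcal H_A$ and $\mathcal H_B$. **Theorem.** Let $\beta>0$ and let $\omega^A$ and $\omega^B$ be KMS$_\beta$ states for the $C^*$-dynamical systems $(A,\varphi_t)$ and $(B,\phi_t)$. Form $A\hat\otimes_\epsilon B$ from any faithful representations of $A$ and $B$. Then there are $*$-automorphisms $\Phi_{t,s}$ $(t,s\in\mathbb R)$ of $A\hat\otimes_\epsilon B$ with $$\Phi_{t,s}(a\otimes b)=\varphi_t(a)\otimes\phi_s(b)\qquad(a\in A,\ b\in B),$$ and for every such family $\Phi$, $(A\hat\otimes_\epsilon B,\Phi_{t,t})$ is a $C^*$-dynamical system which has a KMS$_\beta$ state $\omega$ satisfying $$\omega(a\otimes b)=\omega^A(a)\,\omega^B(b)\qquad(a\in A,\ b\in B).$$ -/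

import Mathlib

open scoped TensorProduct ComplexOrder

noncomputable section

section HilbertTensor

variable (H K : Type*)
  [NormedAddCommGroup H] [InnerProductSpace ℂ H]
  [NormedAddCommGroup K] [InnerProductSpace ℂ K]

/-- The Hilbert space tensor product: the completion of the algebraic tensor product with respect
to the inner product `⟪x ⊗ y, x' ⊗ y'⟫ = ⟪x, x'⟫ * ⟪y, y'⟫`. -/
def HilbertTensor : Type _ := UniformSpace.Completion (H ⊗[ℂ] K)

instance : NormedAddCommGroup (HilbertTensor H K) :=
  inferInstanceAs (NormedAddCommGroup (UniformSpace.Completion (H ⊗[ℂ] K)))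

instance : InnerProductSpace ℂ (HilbertTensor H K) :=
  inferInstanceAs (InnerProductSpace ℂ (UniformSpace.Completion (H ⊗[ℂ] K)))

instance : CompleteSpace (HilbertTensor H K) :=
  inferInstanceAs (CompleteSpace (UniformSpace.Completion (H ⊗[ℂ] K)))

/-- The isometric inclusion of the algebraic tensor product into its completion. -/
def toHilbertTensor : H ⊗[ℂ] K →ₗᵢ[ℂ] HilbertTensor H K :=
  UniformSpace.Completion.toComplₗᵢ (𝕜 := ℂ) (E := H ⊗[ℂ] K)

theorem denseRange_toHilbertTensor : DenseRange (toHilbertTensor H K) :=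
  UniformSpace.Completion.denseRange_coe

variable {H K}

/-- The bounded operator `T ⊗ S` on the Hilbert space tensor product, i.e. the continuous extension
of the map `x ⊗ y ↦ T x ⊗ S y`. -/
def opTensor (T : H →L[ℂ] H) (S : K →L[ℂ] K) : HilbertTensor H K →L[ℂ] HilbertTensor H K :=
  (TensorProduct.mapL T S).completion

theorem opTensor_apply (T : H →L[ℂ] H) (S : K →L[ℂ] K) (x : H ⊗[ℂ] K) :
    opTensor T S (toHilbertTensor H K x) = toHilbertTensor H K (TensorProduct.mapL T S x) :=
  ContinuousLinearMap.completion_apply_coe (TensorProduct.mapL T S) x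

theorem hilbertTensor_clm_ext {f g : HilbertTensor H K →L[ℂ] HilbertTensor H K}
    (h : ∀ x : H ⊗[ℂ] K, f (toHilbertTensor H K x) = g (toHilbertTensor H K x)) : f = g :=
  DFunLike.coe_injective <|
    (denseRange_toHilbertTensor H K).equalizer f.continuous g.continuous (funext h)

theorem opTensor_add_left (T₁ T₂ : H →L[ℂ] H) (S : K →L[ℂ] K) :
    opTensor (T₁ + T₂) S = opTensor T₁ S + opTensor T₂ S :=
  hilbertTensor_clm_ext fun x => by
    simp only [opTensor_apply, add_apply, TensorProduct.mapL_add_left, map_add]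

theorem opTensor_add_right (T : H →L[ℂ] H) (S₁ S₂ : K →L[ℂ] K) :
    opTensor T (S₁ + S₂) = opTensor T S₁ + opTensor T S₂ :=
  hilbertTensor_clm_ext fun x => by
    simp only [opTensor_apply, add_apply, TensorProduct.mapL_add_right, map_add]

theorem opTensor_smul_left (c : ℂ) (T : H →L[ℂ] H) (S : K →L[ℂ] K) :
    opTensor (c • T) S = c • opTensor T S :=
  hilbertTensor_clm_ext fun x => by
    simp only [opTensor_apply, smul_apply, TensorProduct.mapL_smul_left, map_smul]

theorem opTensor_smul_right (c : ℂ) (T : H →L[ℂ] H) (S : K →L[ℂ] K) :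
    opTensor T (c • S) = c • opTensor T S :=
  hilbertTensor_clm_ext fun x => by
    simp only [opTensor_apply, smul_apply, TensorProduct.mapL_smul_right, map_smul]

theorem opTensor_mul (T₁ T₂ : H →L[ℂ] H) (S₁ S₂ : K →L[ℂ] K) :
    opTensor (T₁ * T₂) (S₁ * S₂) = opTensor T₁ S₁ * opTensor T₂ S₂ :=
  hilbertTensor_clm_ext fun x => by
    change _ = opTensor T₁ S₁ (opTensor T₂ S₂ (toHilbertTensor H K x))
    rw [opTensor_apply, opTensor_apply, opTensor_apply, TensorProduct.mapL_mul]
    rfl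

theorem inner_mapL_star [CompleteSpace H] [CompleteSpace K] (T : H →L[ℂ] H) (S : K →L[ℂ] K)
    (x y : H ⊗[ℂ] K) :
    inner ℂ (TensorProduct.mapL (star T) (star S) x) y
      = inner ℂ x (TensorProduct.mapL T S y) := by
  induction x with
  | zero => simp
  | add x₁ x₂ h₁ h₂ => rw [map_add, inner_add_left, inner_add_left, h₁, h₂]
  | tmul a b =>
    induction y with
    | zero => simp
    | add y₁ y₂ h₁ h₂ => rw [map_add, inner_add_right, inner_add_right, h₁, h₂]
    | tmul c d =>
      simp only [TensorProduct.mapL_tmul, TensorProduct.inner_tmul,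
        ContinuousLinearMap.star_eq_adjoint, ContinuousLinearMap.adjoint_inner_left]

theorem opTensor_star [CompleteSpace H] [CompleteSpace K] (T : H →L[ℂ] H) (S : K →L[ℂ] K) :
    opTensor (star T) (star S) = star (opTensor T S) := by
  rw [ContinuousLinearMap.star_eq_adjoint (opTensor T S), ContinuousLinearMap.eq_adjoint_iff]
  intro x y
  refine (denseRange_toHilbertTensor H K).induction_on₂
    (p := fun x y => inner ℂ (opTensor (star T) (star S) x) y = inner ℂ x (opTensor T S y))
    ?_ ?_ x y
  · exact isClosed_eq (by fun_prop) (by fun_prop)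
  · intro x y
    rw [opTensor_apply, opTensor_apply, LinearIsometry.inner_map_map,
      LinearIsometry.inner_map_map, inner_mapL_star]

end HilbertTensor

section InjectiveTensor

variable {A B HA HB : Type*} [NonUnitalCStarAlgebra A] [NonUnitalCStarAlgebra B]
  [NormedAddCommGroup HA] [InnerProductSpace ℂ HA] [CompleteSpace HA]
  [NormedAddCommGroup HB] [InnerProductSpace ℂ HB] [CompleteSpace HB]

/-- The linear map `A ⊗ B → B(HA ⊗ HB)` with `a ⊗ b ↦ πA a ⊗ πB b`. -/
def repTensorLin (πA : A →⋆ₙₐ[ℂ] (HA →L[ℂ] HA)) (πB : B →⋆ₙₐ[ℂ] (HB →L[ℂ] HB)) :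
    A ⊗[ℂ] B →ₗ[ℂ] (HilbertTensor HA HB →L[ℂ] HilbertTensor HA HB) :=
  TensorProduct.lift <| LinearMap.mk₂ ℂ (fun a b => opTensor (πA a) (πB b))
    (fun a₁ a₂ b => by rw [map_add, opTensor_add_left])
    (fun c a b => by rw [map_smul, opTensor_smul_left])
    (fun a b₁ b₂ => by rw [map_add, opTensor_add_right])
    (fun c a b => by rw [map_smul, opTensor_smul_right])

@[simp] theorem repTensorLin_tmul (πA : A →⋆ₙₐ[ℂ] (HA →L[ℂ] HA))
    (πB : B →⋆ₙₐ[ℂ] (HB →L[ℂ] HB)) (a : A) (b : B) :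
    repTensorLin πA πB (a ⊗ₜ[ℂ] b) = opTensor (πA a) (πB b) := rfl

/-- The *-homomorphism `πA ⊗ πB : A ⊗ B → B(HA ⊗ HB)` on the algebraic tensor product. -/
def repTensor (πA : A →⋆ₙₐ[ℂ] (HA →L[ℂ] HA)) (πB : B →⋆ₙₐ[ℂ] (HB →L[ℂ] HB)) :
    A ⊗[ℂ] B →⋆ₙₐ[ℂ] (HilbertTensor HA HB →L[ℂ] HilbertTensor HA HB) where
  toFun := repTensorLin πA πB
  map_smul' c x := (repTensorLin πA πB).map_smul c x
  map_zero' := map_zero _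
  map_add' := map_add _
  map_mul' x y := by
    induction x with
    | zero => simp
    | add x₁ x₂ h₁ h₂ => rw [add_mul, map_add, map_add, add_mul, h₁, h₂]
    | tmul a b =>
      induction y with
      | zero => simp
      | add y₁ y₂ h₁ h₂ => rw [mul_add, map_add, map_add, mul_add, h₁, h₂]
      | tmul c d =>
        rw [Algebra.TensorProduct.tmul_mul_tmul, repTensorLin_tmul, repTensorLin_tmul,
          repTensorLin_tmul, map_mul, map_mul, opTensor_mul]
  map_star' x := by
    induction x with
    | zero => simp
    | add x₁ x₂ h₁ h₂ => rw [star_add, map_add, map_add, star_add, h₁, h₂]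
    | tmul a b =>
      rw [TensorProduct.star_tmul, repTensorLin_tmul, repTensorLin_tmul, map_star, map_star,
        opTensor_star]

/-- The injective tensor product of `A` and `B`. For faithful `πA` and `πB`, the injective norm on
the algebraic tensor product is `‖x‖ = ‖repTensor πA πB x‖`, and its completion is the norm closure
of the range of `repTensor πA πB` in the bounded operators. -/
def injTensor (πA : A →⋆ₙₐ[ℂ] (HA →L[ℂ] HA)) (πB : B →⋆ₙₐ[ℂ] (HB →L[ℂ] HB)) :
    NonUnitalStarSubalgebra ℂ (HilbertTensor HA HB →L[ℂ] HilbertTensor HA HB) :=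
  (NonUnitalStarAlgHom.range (repTensor πA πB)).topologicalClosure

instance injTensor_isClosed (πA : A →⋆ₙₐ[ℂ] (HA →L[ℂ] HA)) (πB : B →⋆ₙₐ[ℂ] (HB →L[ℂ] HB)) :
    IsClosed (injTensor πA πB :
      Set (HilbertTensor HA HB →L[ℂ] HilbertTensor HA HB)) :=
  NonUnitalStarSubalgebra.isClosed_topologicalClosure _

/-- The elementary tensor `a ⊗ b` as an element of the injective tensor product. -/
def injTmul (πA : A →⋆ₙₐ[ℂ] (HA →L[ℂ] HA)) (πB : B →⋆ₙₐ[ℂ] (HB →L[ℂ] HB)) (a : A) (b : B) :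
    injTensor πA πB :=
  ⟨repTensor πA πB (a ⊗ₜ[ℂ] b),
    NonUnitalStarSubalgebra.le_topologicalClosure _
      (Set.mem_range_self (f := repTensor πA πB) (a ⊗ₜ[ℂ] b))⟩

end InjectiveTensor

section KMS

variable {A : Type*} [NonUnitalCStarAlgebra A]

/-- `φ` is a strongly continuous representation of `ℝ` by *-automorphisms of `A`, that is,
`(A, φ)` is a C*-dynamical system. -/
structure IsCStarDynamics (φ : ℝ → (A ≃⋆ₐ[ℂ] A)) : Prop where
  map_zero : ∀ a, φ 0 a = a
  map_add : ∀ s t a, φ (s + t) a = φ s (φ t a)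
  continuous : ∀ a, Continuous fun t => φ t a

/-- `ω` is a KMS state at inverse temperature `β > 0` for the dynamics `φ`: it is positive, of norm
one, and satisfies the KMS condition on the strip `0 < Im z < β`. -/
structure IsKMSState (β : ℝ) (φ : ℝ → (A ≃⋆ₐ[ℂ] A)) (ω : A →L[ℂ] ℂ) : Prop where
  nonneg : ∀ a, 0 ≤ ω (star a * a)
  norm_eq_one : ‖ω‖ = 1
  kms : ∀ a b, ∃ F : ℂ → ℂ,
    DifferentiableOn ℂ F {z | 0 < z.im ∧ z.im < β} ∧
    ContinuousOn F {z | 0 ≤ z.im ∧ z.im ≤ β} ∧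
    ∀ t : ℝ, F t = ω (a * φ t b) ∧ F (t + β * Complex.I) = ω (φ t b * a)

end KMS

end

/-! The product state is a vector state. GNS representations `ρA`, `ρB` realise the two states by
vectors `ΩA`, `ΩB`, and the coefficient of `ρA ⊗ ρB` at `ΩA ⊗ ΩB` is multiplicative on elementary
tensors. It lives on the injective tensor product because faithful representations dominate all
others in the spatial norm (`norm_repTensor_le`): slice maps reduce this to one factor at a time,
and an injective `*`-homomorphism of C*-algebras is isometric. The same domination, applied to `πA ∘
α` and `πB ∘ γ`, extends tensor products of automorphisms.

For the KMS condition, two elementary tensors are served by the product of the two strip functions.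
Sums are immediate, and norm limits follow from the maximum principle on the strip
(`IsStripBoundary.of_tendstoUniformly`), which needs bounded functions. The definition of a KMS
state does not provide boundedness, so it is proved first (`IsKMSState.satisfiesKMS`). If `b` is
averaged along its orbit against a Gaussian, the correlation function on the real line extends to an
entire function bounded on horizontal strips. By uniqueness (`eqOn_zero_of_eq_zero_on_real`) the KMS
function coincides with it and is bounded. Narrowing the Gaussian recovers `b`. -/

/-! ### Holomorphic functions on a strip and their boundary values -/

section Strip

open Set Filter Topology Complex

/-- The open strip `0 < Im z < β`. -/
def openStrip (β : ℝ) : Set ℂ := {z | 0 < z.im ∧ z.im < β}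

/-- The closed strip `0 ≤ Im z ≤ β`. -/
def closedStrip (β : ℝ) : Set ℂ := {z | 0 ≤ z.im ∧ z.im ≤ β}

theorem openStrip_subset_closedStrip (β : ℝ) : openStrip β ⊆ closedStrip β :=
  fun _ h => ⟨h.1.le, h.2.le⟩

theorem isOpen_openStrip (β : ℝ) : IsOpen (openStrip β) :=
  (isOpen_lt continuous_const continuous_im).inter (isOpen_lt continuous_im continuous_const)

theorem isPreconnected_openStrip (β : ℝ) : IsPreconnected (openStrip β) :=
  ((convex_halfSpace_im_gt 0).inter (convex_halfSpace_im_lt β)).isPreconnected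

theorem closure_openStrip {β : ℝ} (hβ : 0 < β) : closure (openStrip β) = closedStrip β := by
  have h : openStrip β = im ⁻¹' Ioo 0 β := rfl
  rw [h, closure_preimage_im, closure_Ioo hβ.ne]
  rfl

theorem diffContOnCl_openStrip {β : ℝ} (hβ : 0 < β) {F : ℂ → ℂ}
    (hd : DifferentiableOn ℂ F (openStrip β)) (hc : ContinuousOn F (closedStrip β)) :
    DiffContOnCl ℂ F (openStrip β) :=
  ⟨hd, by rwa [closure_openStrip hβ]⟩

/-- The three lines theorem in the form of a maximum principle for bounded functions on a strip. -/
theorem norm_le_of_norm_le_boundary_strip {β C M : ℝ} (hβ : 0 < β) {F : ℂ → ℂ}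
    (hd : DifferentiableOn ℂ F (openStrip β)) (hc : ContinuousOn F (closedStrip β))
    (hM : ∀ z ∈ closedStrip β, ‖F z‖ ≤ M)
    (h0 : ∀ t : ℝ, ‖F t‖ ≤ C) (h1 : ∀ t : ℝ, ‖F (t + β * I)‖ ≤ C) {z : ℂ}
    (hz : z ∈ closedStrip β) : ‖F z‖ ≤ C := by
  -- A bounded function meets the growth condition with both exponential constants equal to zero.
  refine PhragmenLindelof.horizontal_strip (a := 0) (b := β) (diffContOnCl_openStrip hβ hd hc)
    ⟨0, by positivity, 0, ?_⟩ (fun w hw => ?_) (fun w hw => ?_) hz.1 hz.2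
  · refine Asymptotics.IsBigO.of_bound M ?_
    refine Eventually.filter_mono inf_le_right ?_
    refine eventually_principal.2 fun w hw => ?_
    simpa using hM w (openStrip_subset_closedStrip β hw)
  · have : w = (w.re : ℂ) := by apply Complex.ext <;> simp [hw]
    rw [this]; exact h0 _
  · have : w = (w.re : ℂ) + β * I := by apply Complex.ext <;> simp [hw]
    rw [this]; exact h1 _

/-- A function on a strip that is holomorphic inside, continuous up to the boundary, and zero on the
lower boundary line vanishes identically. -/
theorem eqOn_zero_of_eq_zero_on_real {β : ℝ} (hβ : 0 < β) {G : ℂ → ℂ}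
    (hd : DifferentiableOn ℂ G (openStrip β)) (hc : ContinuousOn G (closedStrip β))
    (h0 : ∀ t : ℝ, G t = 0) : EqOn G 0 (closedStrip β) := by
  -- The half-width `2 * β` is large enough to make `Re p` negative on the vertical sides of the
  -- rectangle, for the quadratic `p` chosen below.
  set Q : Set ℂ := Ioo (-(2 * β)) (2 * β) ×ℂ Ioo 0 β with hQ
  have hclQ : closure Q = Icc (-(2 * β)) (2 * β) ×ℂ Icc 0 β := by
    rw [hQ, closure_reProdIm, closure_Ioo (by linarith), closure_Ioo hβ.ne]
  have hQc : IsCompact (closure Q) := by rw [hclQ]; exact isCompact_Icc.reProdIm isCompact_Icc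
  have hQs : closure Q ⊆ closedStrip β := by
    rw [hclQ]; exact fun z hz => ⟨hz.2.1, hz.2.2⟩
  have hQo : Q ⊆ openStrip β := fun z hz => ⟨hz.2.1, hz.2.2⟩
  obtain ⟨M, hM⟩ := hQc.exists_bound_of_continuousOn (hc.mono hQs)
  -- `Re p` is nonpositive on three sides of the rectangle and positive near its lower side
  set p : ℂ → ℂ := fun z => (β / 4 : ℝ) + I * z - ((1 / (2 * β) : ℝ) : ℂ) * z ^ 2 with hp
  have hpre : ∀ z : ℂ, (p z).re = β / 4 - z.im + 1 / (2 * β) * (z.im ^ 2 - z.re ^ 2) := by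
    intro z
    simp only [hp, sub_re, add_re, ofReal_re, mul_re, I_re, I_im, ofReal_im, sq]
    ring
  have hpd : Differentiable ℂ p := by unfold p; fun_prop
  -- On the lower side `G` vanishes; on the other three the weight `exp (N * p)` has modulus at most
  -- one. The maximum principle carries the bound `M`, which is independent of `N`, inside.
  have key : ∀ z ∈ closure Q, ∀ N : ℕ, ‖G z‖ * Real.exp (N * (p z).re) ≤ M := by
    intro z hz N
    have hMnn : 0 ≤ M := (norm_nonneg _).trans (hM z hz)
    have hE : ∀ w, ‖G w * exp (N * p w)‖ = ‖G w‖ * Real.exp (N * (p w).re) := by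
      intro w; rw [norm_mul, norm_exp]; simp
    have hfr : ∀ w ∈ frontier Q, ‖G w * exp (N * p w)‖ ≤ M := by
      intro w hw
      have hwcl : w ∈ closure Q := frontier_subset_closure hw
      have hGw := hM w hwcl
      rw [hE]
      suffices h : G w = 0 ∨ (p w).re ≤ 0 by
        rcases h with h | h
        · simpa [h] using hMnn
        · have : Real.exp (N * (p w).re) ≤ 1 :=
            Real.exp_le_one_iff.2 (mul_nonpos_of_nonneg_of_nonpos (Nat.cast_nonneg _) h)
          nlinarith [norm_nonneg (G w)]
      rw [hclQ] at hwcl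
      obtain ⟨⟨hr1, hr2⟩, hi1, hi2⟩ := hwcl
      rw [hQ, frontier_reProdIm, frontier_Ioo hβ,
        frontier_Ioo (show -(2 * β) < 2 * β by linarith)] at hw
      have e1 : 1 / (2 * β) * β ^ 2 = β / 2 := by field_simp
      have e0 : 0 < 1 / (2 * β) := by positivity
      rw [hpre]
      rcases hw with ⟨-, hw⟩ | ⟨hw, -⟩
      · rcases hw with hw | hw
        · left
          have : w = (w.re : ℂ) := by apply Complex.ext <;> simp [show w.im = 0 from hw]
          rw [this]; exact h0 _
        · right
          rw [show w.im = β from hw]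
          nlinarith [mul_nonneg e0.le (sq_nonneg w.re)]
      · right
        have h4 : w.re ^ 2 = 4 * β ^ 2 := by
          rcases hw with hw | hw
          · rw [show w.re = _ from hw]; ring
          · rw [show w.re = _ from hw]; ring
        have h5 : w.im ^ 2 ≤ β ^ 2 := by nlinarith
        rw [h4]
        nlinarith [mul_le_mul_of_nonneg_left h5 e0.le]
    have hdc : DiffContOnCl ℂ (fun w => G w * exp (N * p w)) Q := by
      refine ⟨(hd.mono hQo).mul ?_, (hc.mono hQs).mul ?_⟩
      · exact (((hpd.const_mul _).cexp).differentiableOn)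
      · exact (((hpd.const_mul _).cexp).continuous.continuousOn)
    rw [← hE]
    exact norm_le_of_forall_mem_frontier_norm_le
      (hQc.isBounded.subset subset_closure) hdc hfr hz
  -- Where `Re p` is positive the weight grows without bound in `N`, so `G` must vanish there.
  have hzero : ∀ z ∈ Q, 0 < (p z).re → G z = 0 := by
    intro z hz hpos
    by_contra hne
    have hGpos : 0 < ‖G z‖ := norm_pos_iff.2 hne
    obtain ⟨N, hN⟩ := exists_nat_gt (M / ‖G z‖ / (p z).re)
    have h1 := key z (subset_closure hz) N
    rw [div_lt_iff₀ hpos] at hN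
    have h2 := Real.add_one_le_exp (N * (p z).re)
    rw [← le_div_iff₀' hGpos] at h1
    linarith
  -- Any interior point close to the lower side would do; here `Re p` is at least `β / 8`. The
  -- identity theorem then spreads the zeros around it to the whole strip.
  set z₀ : ℂ := ((β / 8 : ℝ) : ℂ) * I with hz₀
  have hz₀im : z₀.im = β / 8 := by simp [hz₀]
  have hz₀re : z₀.re = 0 := by simp [hz₀]
  have hz₀Q : z₀ ∈ Q := by
    refine mem_reProdIm.2 ⟨?_, ?_⟩
    · rw [hz₀re]; constructor <;> linarith
    · rw [hz₀im]; constructor <;> linarith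
  have hQopen : IsOpen Q := isOpen_Ioo.reProdIm isOpen_Ioo
  have hev : G =ᶠ[𝓝 z₀] 0 := by
    have hpos : 0 < (p z₀).re := by
      rw [hpre, hz₀im, hz₀re]
      have : 0 ≤ 1 / (2 * β) * ((β / 8) ^ 2 - 0 ^ 2) := by
        rw [zero_pow two_ne_zero, sub_zero]; positivity
      linarith
    filter_upwards [hQopen.mem_nhds hz₀Q,
      (continuous_re.comp hpd.continuous).continuousAt.eventually (lt_mem_nhds hpos)] with z h1 h2
    exact hzero z h1 h2
  have hopen : EqOn G 0 (openStrip β) :=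
    (hd.analyticOnNhd (isOpen_openStrip β)).eqOn_zero_of_preconnected_of_eventuallyEq_zero
      (isPreconnected_openStrip β) (hQo hz₀Q) hev
  refine hopen.of_subset_closure hc continuousOn_const (openStrip_subset_closedStrip β) ?_
  rw [closure_openStrip hβ]

/-- `f` and `g` are the boundary values, on the lines `Im z = 0` and `Im z = β`, of a bounded
continuous function on the closed strip that is holomorphic in the interior. -/
def IsStripBoundary (β : ℝ) (f g : ℝ → ℂ) : Prop :=
  ∃ F : ℂ → ℂ, DifferentiableOn ℂ F (openStrip β) ∧ ContinuousOn F (closedStrip β) ∧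
    (∃ M, ∀ z ∈ closedStrip β, ‖F z‖ ≤ M) ∧ ∀ t : ℝ, F t = f t ∧ F (t + β * I) = g t

namespace IsStripBoundary

variable {β : ℝ} {f g f' g' : ℝ → ℂ}

theorem zero : IsStripBoundary β (fun _ => 0) (fun _ => 0) :=
  ⟨fun _ => 0, differentiableOn_const _, continuousOn_const, ⟨0, by simp⟩, by simp⟩

theorem add (h : IsStripBoundary β f g) (h' : IsStripBoundary β f' g') :
    IsStripBoundary β (fun t => f t + f' t) (fun t => g t + g' t) := by
  obtain ⟨F, hd, hc, ⟨M, hM⟩, hb⟩ := h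
  obtain ⟨F', hd', hc', ⟨M', hM'⟩, hb'⟩ := h'
  exact ⟨fun z => F z + F' z, hd.add hd', hc.add hc',
    ⟨M + M', fun z hz => norm_add_le_of_le (hM z hz) (hM' z hz)⟩,
    fun t => ⟨by simp only [(hb t).1, (hb' t).1], by simp only [(hb t).2, (hb' t).2]⟩⟩

/-- This is what settles the KMS condition on elementary tensors: the strip function of a product
functional is the product of the strip functions. -/
theorem mul (h : IsStripBoundary β f g) (h' : IsStripBoundary β f' g') :
    IsStripBoundary β (fun t => f t * f' t) (fun t => g t * g' t) := by
  obtain ⟨F, hd, hc, ⟨M, hM⟩, hb⟩ := h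
  obtain ⟨F', hd', hc', ⟨M', hM'⟩, hb'⟩ := h'
  exact ⟨fun z => F z * F' z, hd.mul hd', hc.mul hc',
    ⟨M * M', fun z hz => norm_mul_le_of_le (hM z hz) (hM' z hz)⟩,
    fun t => ⟨by simp only [(hb t).1, (hb' t).1], by simp only [(hb t).2, (hb' t).2]⟩⟩

/-- Boundary values of bounded holomorphic functions on a strip are closed under uniform limits. -/
theorem of_tendstoUniformly (hβ : 0 < β) {fn gn : ℕ → ℝ → ℂ}
    (h : ∀ n, IsStripBoundary β (fn n) (gn n)) (hf : TendstoUniformly fn f atTop)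
    (hg : TendstoUniformly gn g atTop) : IsStripBoundary β f g := by
  choose F hd hc hM hb using h
  -- Differences of the extensions are bounded, so the maximum principle turns the uniform Cauchy
  -- property on the two boundary lines into one on the closed strip.
  have hcauchy : UniformCauchySeqOn F atTop (closedStrip β) := by
    rw [Metric.uniformCauchySeqOn_iff]
    intro ε hε
    have hf' := (Metric.uniformCauchySeqOn_iff.1
      (tendstoUniformlyOn_univ.2 hf).uniformCauchySeqOn) (ε / 2) (half_pos hε)
    have hg' := (Metric.uniformCauchySeqOn_iff.1
      (tendstoUniformlyOn_univ.2 hg).uniformCauchySeqOn) (ε / 2) (half_pos hε)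
    obtain ⟨N₁, hN₁⟩ := hf'
    obtain ⟨N₂, hN₂⟩ := hg'
    refine ⟨max N₁ N₂, fun m hm n hn z hz => ?_⟩
    obtain ⟨Mm, hMm⟩ := hM m
    obtain ⟨Mn, hMn⟩ := hM n
    rw [dist_eq_norm]
    refine lt_of_le_of_lt ?_ (half_lt_self hε)
    refine norm_le_of_norm_le_boundary_strip (F := fun z => F m z - F n z) hβ
      ((hd m).sub (hd n)) ((hc m).sub (hc n)) (M := Mm + Mn)
      (fun w hw => (norm_sub_le _ _).trans (add_le_add (hMm w hw) (hMn w hw)))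
      (fun t => ?_) (fun t => ?_) hz
    · rw [(hb m t).1, (hb n t).1, ← dist_eq_norm]
      exact (hN₁ m (le_of_max_le_left hm) n (le_of_max_le_left hn) t (mem_univ _)).le
    · rw [(hb m t).2, (hb n t).2, ← dist_eq_norm]
      exact (hN₂ m (le_of_max_le_right hm) n (le_of_max_le_right hn) t (mem_univ _)).le
  -- Off the strip the limit is never used, and the value is a dummy.
  have hex : ∀ z, ∃ w, z ∈ closedStrip β → Tendsto (fun n => F n z) atTop (𝓝 w) := by
    intro z
    by_cases hz : z ∈ closedStrip β
    · obtain ⟨w, hw⟩ := cauchySeq_tendsto_of_complete (hcauchy.cauchySeq hz)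
      exact ⟨w, fun _ => hw⟩
    · exact ⟨0, fun h => absurd h hz⟩
  choose G hG using hex
  have hunif : TendstoUniformlyOn F G atTop (closedStrip β) :=
    hcauchy.tendstoUniformlyOn_of_tendsto fun z hz => hG z hz
  refine ⟨G, ?_, ?_, ?_, fun t => ⟨?_, ?_⟩⟩
  · exact (hunif.mono (openStrip_subset_closedStrip β)).tendstoLocallyUniformlyOn.differentiableOn
      (Eventually.of_forall hd) (isOpen_openStrip β)
  · exact hunif.continuousOn (Frequently.of_forall hc)
  · obtain ⟨N, hN⟩ := (Metric.tendstoUniformlyOn_iff.1 hunif 1 one_pos).exists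
    obtain ⟨M, hM⟩ := hM N
    refine ⟨1 + M, fun z hz => ?_⟩
    have h1 := (hN z hz).le
    rw [dist_eq_norm] at h1
    calc ‖G z‖ = ‖(G z - F N z) + F N z‖ := by rw [sub_add_cancel]
      _ ≤ 1 + M := norm_add_le_of_le h1 (hM z hz)
  · have hz : (t : ℂ) ∈ closedStrip β := by simp [closedStrip, hβ.le]
    refine tendsto_nhds_unique (hG _ hz) ?_
    simpa only [(hb _ t).1] using hf.tendsto_at t
  · have hz : (t : ℂ) + β * I ∈ closedStrip β := by simp [closedStrip, hβ.le]
    refine tendsto_nhds_unique (hG _ hz) ?_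
    simpa only [(hb _ t).2] using hg.tendsto_at t

end IsStripBoundary

end Strip

/-! ### Gaussian convolutions as entire functions -/

section GaussianSmoothing

open MeasureTheory Complex Set

variable {f : ℝ → ℂ} {M b : ℝ}

theorem norm_exp_neg_mul_sub_sq (b u : ℝ) (z : ℂ) :
    ‖exp (-b * (u - z) ^ 2)‖ = Real.exp (b * z.im ^ 2) * Real.exp (-b * (u - z.re) ^ 2) := by
  rw [norm_exp, ← Real.exp_add]
  congr 1
  simp [sq]
  ring

theorem integrable_mul_gaussian (hb : 0 < b) (hf : Continuous f) (hM : ∀ u, ‖f u‖ ≤ M) (z : ℂ) :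
    Integrable fun u : ℝ => f u * exp (-b * (u - z) ^ 2) := by
  refine Integrable.bdd_mul (c := M) ?_ hf.aestronglyMeasurable (Filter.Eventually.of_forall hM)
  rw [← integrable_norm_iff (by fun_prop)]
  simp only [norm_exp_neg_mul_sub_sq]
  exact ((integrable_exp_neg_mul_sq hb).comp_sub_right z.re).const_mul _

/-- Translating by `z.re` leaves a bound that depends on `z.im` alone, hence one uniform on
horizontal strips of finite width. -/
theorem norm_integral_mul_gaussian_le (hb : 0 < b) (hM : ∀ u, ‖f u‖ ≤ M)
    (z : ℂ) : ‖∫ u : ℝ, f u * exp (-b * (u - z) ^ 2)‖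
      ≤ M * Real.exp (b * z.im ^ 2) * ∫ u : ℝ, Real.exp (-b * u ^ 2) := by
  rw [← integral_sub_right_eq_self (fun u => Real.exp (-b * u ^ 2)) z.re,
    ← integral_const_mul]
  refine norm_integral_le_of_norm_le
    (((integrable_exp_neg_mul_sq hb).comp_sub_right z.re).const_mul _)
    (Filter.Eventually.of_forall fun u => ?_)
  rw [norm_mul, norm_exp_neg_mul_sub_sq, mul_assoc]
  gcongr
  exact hM u

/-- The convolution of a bounded function with a Gaussian extends to an entire function. -/
theorem differentiable_integral_mul_gaussian (hb : 0 < b) (hf : Continuous f)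
    (hM : ∀ u, ‖f u‖ ≤ M) :
    Differentiable ℂ fun z : ℂ => ∫ u : ℝ, f u * exp (-b * (u - z) ^ 2) := by
  intro z₀
  set c : ℝ := |z₀.im| + 1
  have hM0 : 0 ≤ M := (norm_nonneg _).trans (hM 0)
  -- The integrable majorant of the derivative over the unit ball around `z₀`, where `c` bounds
  -- `|z.im|`. Recentring the Gaussian from `z.re` to `z₀.re` uses `(u - z₀.re)² ≤ 2 (u - z.re)² +
  -- 2`; this halves the rate `b` and costs a factor `exp b`.
  have hint : Integrable fun u : ℝ => M * (2 * b) * Real.exp (b * c ^ 2 + b) *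
      ((|u - z₀.re| + (1 + c)) * Real.exp (-(b / 2) * (u - z₀.re) ^ 2)) := by
    refine Integrable.const_mul ?_ _
    have h1 : Integrable fun v : ℝ => (|v| + (1 + c)) * Real.exp (-(b / 2) * v ^ 2) := by
      have h2 := (integrable_mul_exp_neg_mul_sq (half_pos hb)).norm
      have h3 := (integrable_exp_neg_mul_sq (half_pos hb)).const_mul (1 + c)
      refine (h2.add h3).congr (Filter.Eventually.of_forall fun v => ?_)
      simp [add_mul]
    exact h1.comp_sub_right z₀.re
  refine (hasDerivAt_integral_of_dominated_loc_of_deriv_le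
    (F := fun (z : ℂ) (u : ℝ) => f u * exp (-b * (u - z) ^ 2))
    (F' := fun (z : ℂ) (u : ℝ) => f u * (exp (-b * (u - z) ^ 2) * (2 * b * (u - z))))
    (Metric.ball_mem_nhds z₀ one_pos)
    (Filter.Eventually.of_forall fun z => (integrable_mul_gaussian hb hf hM z).1)
    (integrable_mul_gaussian hb hf hM z₀) (by fun_prop)
    (Filter.Eventually.of_forall fun u z hz => ?_) hint
    (Filter.Eventually.of_forall fun u z _ => ?_)).2.differentiableAt
  · have hd : ‖z - z₀‖ < 1 := by simpa [dist_eq_norm] using hz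
    have hre : |z.re - z₀.re| ≤ 1 := by
      simpa using (abs_re_le_norm (z - z₀)).trans hd.le
    have him : |z.im - z₀.im| ≤ 1 := by
      simpa using (abs_im_le_norm (z - z₀)).trans hd.le
    have himc : |z.im| ≤ c := by
      have := abs_sub_abs_le_abs_sub z.im z₀.im
      simp only [c]; linarith
    have hw : ‖(u : ℂ) - z‖ ≤ |u - z₀.re| + (1 + c) := by
      refine (norm_le_abs_re_add_abs_im _).trans ?_
      simp only [sub_re, ofReal_re, sub_im, ofReal_im, zero_sub, abs_neg]
      have : |u - z.re| ≤ |u - z₀.re| + |z.re - z₀.re| := by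
        rw [abs_sub_comm z.re]; exact abs_sub_le _ _ _
      linarith
    have hsq : z.im ^ 2 ≤ c ^ 2 := sq_le_sq' (by linarith [neg_abs_le z.im])
      (by linarith [le_abs_self z.im])
    have hexp : Real.exp (b * z.im ^ 2) * Real.exp (-b * (u - z.re) ^ 2)
        ≤ Real.exp (b * c ^ 2 + b) * Real.exp (-(b / 2) * (u - z₀.re) ^ 2) := by
      rw [← Real.exp_add, ← Real.exp_add]
      apply Real.exp_le_exp.2
      have h1 : (u - z₀.re) ^ 2 ≤ 2 * (u - z.re) ^ 2 + 2 := by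
        have : (z.re - z₀.re) ^ 2 ≤ 1 := by
          rw [← sq_abs]; nlinarith [abs_nonneg (z.re - z₀.re)]
        nlinarith [sq_nonneg ((u - z.re) - (z.re - z₀.re))]
      nlinarith [mul_le_mul_of_nonneg_left h1 hb.le, mul_le_mul_of_nonneg_left hsq hb.le]
    rw [norm_mul, norm_mul, norm_exp_neg_mul_sub_sq]
    have h2b : ‖(2 * b * (u - z) : ℂ)‖ = 2 * b * ‖(u : ℂ) - z‖ := by
      simp [abs_of_pos hb]
    rw [h2b]
    calc ‖f u‖ * (Real.exp (b * z.im ^ 2) * Real.exp (-b * (u - z.re) ^ 2) *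
          (2 * b * ‖(u : ℂ) - z‖))
        ≤ M * (Real.exp (b * c ^ 2 + b) * Real.exp (-(b / 2) * (u - z₀.re) ^ 2) *
          (2 * b * (|u - z₀.re| + (1 + c)))) := by
          gcongr
          exact hM u
      _ = _ := by ring
  · have h1 : HasDerivAt (fun z : ℂ => -b * (u - z) ^ 2) (2 * b * (u - z)) z := by
      have := (((hasDerivAt_id z).const_sub (u : ℂ)).pow 2).const_mul (-b : ℂ)
      exact this.congr_deriv (by norm_num; ring)
    exact (h1.cexp).const_mul _

end GaussianSmoothing

/-! ### Bounded KMS functions from Gaussian averages -/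

section Dynamics

open MeasureTheory Complex Set Filter Topology

variable {A : Type*} [NonUnitalCStarAlgebra A]

/-- A `*`-automorphism as a continuous linear map. -/
def StarAlgEquiv.toCLM (e : A ≃⋆ₐ[ℂ] A) : A →L[ℂ] A where
  toFun := e
  map_add' := map_add e
  map_smul' := map_smul e
  cont := (StarAlgEquiv.isometry e).continuous

theorem StarAlgEquiv.toCLM_apply (e : A ≃⋆ₐ[ℂ] A) (a : A) : e.toCLM a = e a := rfl

/-- The two correlation functions of `x` and `y` are the boundary values of a bounded holomorphic
function on the strip. -/
def SatisfiesKMS (β : ℝ) (φ : ℝ → (A ≃⋆ₐ[ℂ] A)) (ω : A →L[ℂ] ℂ) (x y : A) : Prop :=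
  IsStripBoundary β (fun t => ω (x * φ t y)) (fun t => ω (φ t y * x))

namespace SatisfiesKMS

variable {β : ℝ} {φ : ℝ → (A ≃⋆ₐ[ℂ] A)} {ω : A →L[ℂ] ℂ} {x x' y y' : A}

theorem zero_left : SatisfiesKMS β φ ω 0 y := by
  simpa [SatisfiesKMS] using IsStripBoundary.zero

theorem zero_right : SatisfiesKMS β φ ω x 0 := by
  simpa [SatisfiesKMS] using IsStripBoundary.zero

theorem add_left (h : SatisfiesKMS β φ ω x y) (h' : SatisfiesKMS β φ ω x' y) :
    SatisfiesKMS β φ ω (x + x') y := by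
  simpa [SatisfiesKMS, add_mul, mul_add] using IsStripBoundary.add h h'

theorem add_right (h : SatisfiesKMS β φ ω x y) (h' : SatisfiesKMS β φ ω x y') :
    SatisfiesKMS β φ ω x (y + y') := by
  simpa [SatisfiesKMS, add_mul, mul_add] using IsStripBoundary.add h h'

/-- Automorphisms are isometric, so norm convergence of both arguments makes the correlation
functions converge uniformly in `t`. -/
theorem of_tendsto (hβ : 0 < β) {xn yn : ℕ → A} (h : ∀ n, SatisfiesKMS β φ ω (xn n) (yn n))
    (hx : Tendsto xn atTop (𝓝 x)) (hy : Tendsto yn atTop (𝓝 y)) : SatisfiesKMS β φ ω x y := by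
  have hlim : Tendsto (fun n => ‖ω‖ * (‖x - xn n‖ * ‖y‖ + ‖xn n‖ * ‖y - yn n‖)) atTop (𝓝 0) := by
    have h1 : Tendsto (fun n => ‖ω‖ * (‖x - xn n‖ * ‖y‖ + ‖xn n‖ * ‖y - yn n‖)) atTop
        (𝓝 (‖ω‖ * (‖x - x‖ * ‖y‖ + ‖x‖ * ‖y - y‖))) :=
      tendsto_const_nhds.mul ((((tendsto_const_nhds.sub hx).norm).mul_const _).add
        (hx.norm.mul (tendsto_const_nhds.sub hy).norm))
    simpa using h1
  refine IsStripBoundary.of_tendstoUniformly hβ h ?_ ?_ <;>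
  · rw [Metric.tendstoUniformly_iff]
    intro ε hε
    filter_upwards [hlim.eventually (gt_mem_nhds hε)] with n hn t
    refine lt_of_le_of_lt ?_ hn
    rw [dist_eq_norm, ← map_sub]
    refine (ω.le_opNorm _).trans (mul_le_mul_of_nonneg_left ?_ (norm_nonneg _))
    have e1 : x * φ t y - xn n * φ t (yn n) = (x - xn n) * φ t y + xn n * φ t (y - yn n) := by
      rw [map_sub, sub_mul, mul_sub]; abel
    have e2 : φ t y * x - φ t (yn n) * xn n = φ t y * (x - xn n) + φ t (y - yn n) * xn n := by
      rw [map_sub, mul_sub, sub_mul]; abel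
    first
    | rw [e1]
      refine norm_add_le_of_le ((norm_mul_le _ _).trans ?_) ((norm_mul_le _ _).trans ?_)
      · rw [StarAlgEquiv.norm_map]
      · rw [StarAlgEquiv.norm_map]
    | rw [e2]
      refine norm_add_le_of_le ((norm_mul_le _ _).trans ?_) ((norm_mul_le _ _).trans ?_)
      · rw [StarAlgEquiv.norm_map, mul_comm]
      · rw [StarAlgEquiv.norm_map, mul_comm]

end SatisfiesKMS

theorem integrable_exp_neg_sq : Integrable fun s : ℝ => exp (-(s : ℂ) ^ 2) := by
  simpa using integrable_cexp_neg_mul_sq (b := 1) (by simp)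

variable {φ : ℝ → (A ≃⋆ₐ[ℂ] A)}

/-- The average of `φ s b` over `s` against a Gaussian of width `δ` and total mass `√π`. -/
noncomputable def gaussianAverage (φ : ℝ → (A ≃⋆ₐ[ℂ] A)) (δ : ℝ) (b : A) : A :=
  ∫ s : ℝ, exp (-(s : ℂ) ^ 2) • φ (δ * s) b

theorem IsCStarDynamics.integrable_gaussian (hφ : IsCStarDynamics φ) (δ : ℝ) (b : A) :
    Integrable fun s : ℝ => exp (-(s : ℂ) ^ 2) • φ (δ * s) b := by
  refine (integrable_exp_neg_sq.smul_const b).mono ?_ (Eventually.of_forall fun s => ?_)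
  · have := hφ.continuous b
    exact Continuous.aestronglyMeasurable (by fun_prop)
  · rw [norm_smul, norm_smul, StarAlgEquiv.norm_map]

/-- Dominated convergence: as the width shrinks, each orbit point `φ (δ * s) b` tends to `b`, with
constant norm along the way. -/
theorem IsCStarDynamics.tendsto_gaussianAverage (hφ : IsCStarDynamics φ) (b : A) :
    Tendsto (fun n : ℕ => gaussianAverage φ (1 / ((n : ℝ) + 1)) b) atTop
      (𝓝 ((∫ s : ℝ, exp (-(s : ℂ) ^ 2)) • b)) := by
  rw [← integral_smul_const]
  refine tendsto_integral_of_dominated_convergence (fun s => ‖exp (-(s : ℂ) ^ 2)‖ * ‖b‖)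
    (fun n => (hφ.integrable_gaussian _ b).1) (integrable_exp_neg_sq.norm.mul_const _)
    (fun n => Eventually.of_forall fun s => ?_) (Eventually.of_forall fun s => ?_)
  · rw [norm_smul, StarAlgEquiv.norm_map]
  · refine Tendsto.const_smul ?_ _
    have h1 : Tendsto (fun n : ℕ => 1 / ((n : ℝ) + 1) * s) atTop (𝓝 0) := by
      simpa using (tendsto_one_div_add_atTop_nhds_zero_nat (𝕜 := ℝ)).mul_const s
    have h2 := ((hφ.continuous b).tendsto 0).comp h1
    rwa [hφ.map_zero] at h2

/-- The substitution `u = t + δ * s` moves `t` from the dynamics into the Gaussian kernel, where it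
may be replaced by a complex variable. -/
theorem IsCStarDynamics.apply_gaussianAverage (hφ : IsCStarDynamics φ) (ω : A →L[ℂ] ℂ) {δ : ℝ}
    (hδ : 0 < δ) (a b : A) (t : ℝ) :
    ω (a * φ t (gaussianAverage φ δ b)) =
      δ⁻¹ * ∫ u : ℝ, ω (a * φ u b) * exp (-((1 / δ ^ 2 : ℝ) : ℂ) * (u - (t : ℂ)) ^ 2) := by
  have h1 := (ω.comp ((ContinuousLinearMap.mul ℂ A a).comp (φ t).toCLM)).integral_comp_comm
    (hφ.integrable_gaussian δ b)
  simp only [ContinuousLinearMap.comp_apply, ContinuousLinearMap.mul_apply',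
    StarAlgEquiv.toCLM_apply] at h1
  rw [gaussianAverage, ← h1]
  set g : ℝ → ℂ := fun u => ω (a * φ u b) * exp (-((1 / δ ^ 2 : ℝ) : ℂ) * (u - (t : ℂ)) ^ 2)
    with hg
  have h2 : ∀ s : ℝ, ω (a * φ t (exp (-(s : ℂ) ^ 2) • φ (δ * s) b)) = g (t + δ * s) := by
    intro s
    have hδ' : (δ : ℂ) ≠ 0 := by exact_mod_cast hδ.ne'
    simp only [hg, map_smul, mul_smul_comm, smul_eq_mul, ← hφ.map_add]
    rw [mul_comm]
    congr 2
    push_cast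
    field_simp
    ring
  simp only [h2]
  rw [Measure.integral_comp_mul_left (fun v => g (t + v)) δ,
    integral_add_left_eq_self (fun v => g v) t, abs_of_pos (inv_pos.2 hδ), real_smul]

/-- The functions in the KMS condition can be chosen bounded on the closed strip. -/
theorem IsKMSState.satisfiesKMS {β : ℝ} (hβ : 0 < β) (hφ : IsCStarDynamics φ) {ω : A →L[ℂ] ℂ}
    (hω : IsKMSState β φ ω) (a b : A) : SatisfiesKMS β φ ω a b := by
  -- The averages have total mass `k` rather than one, which is why `k⁻¹ • b` is smoothed in place
  -- of `b` at the end.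
  set k : ℂ := ∫ s : ℝ, exp (-(s : ℂ) ^ 2) with hk
  have hk0 : k ≠ 0 := by
    have := integral_gaussian_complex (b := 1) (by simp)
    simp only [neg_mul, one_mul, div_one] at this
    rw [hk, this]
    simp [Complex.cpow_eq_zero_iff, Real.pi_ne_zero]
  have hsmooth : ∀ (c : A) (δ : ℝ), 0 < δ → SatisfiesKMS β φ ω a (gaussianAverage φ δ c) := by
    intro c δ hδ
    obtain ⟨F, hd, hc, hF⟩ := hω.kms a (gaussianAverage φ δ c)
    refine ⟨F, hd, hc, ?_, hF⟩
    have hb : 0 < 1 / δ ^ 2 := by positivity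
    have hcont : Continuous fun u => ω (a * φ u c) := by
      have := hφ.continuous c
      fun_prop
    have hM : ∀ u, ‖ω (a * φ u c)‖ ≤ ‖ω‖ * (‖a‖ * ‖c‖) := fun u => by
      refine (ω.le_opNorm _).trans (mul_le_mul_of_nonneg_left ?_ (norm_nonneg _))
      exact (norm_mul_le _ _).trans (by rw [StarAlgEquiv.norm_map])
    -- The explicit entire extension. It agrees with `F` on the real line, hence on the closed
    -- strip, and so transfers its bound to `F`.
    set H : ℂ → ℂ := fun z =>
      δ⁻¹ * ∫ u : ℝ, ω (a * φ u c) * exp (-((1 / δ ^ 2 : ℝ) : ℂ) * (u - z) ^ 2)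
    have hH : Differentiable ℂ H := (differentiable_integral_mul_gaussian hb hcont hM).const_mul _
    have hEq := eqOn_zero_of_eq_zero_on_real (G := fun z => F z - H z) hβ
      (hd.sub hH.differentiableOn) (hc.sub hH.continuous.continuousOn)
      (fun t => by
        simp only [(hF t).1, H, hφ.apply_gaussianAverage ω hδ a c t, sub_self])
    refine ⟨δ⁻¹ * (‖ω‖ * (‖a‖ * ‖c‖) * Real.exp (1 / δ ^ 2 * β ^ 2) *
      ∫ u : ℝ, Real.exp (-(1 / δ ^ 2) * u ^ 2)), fun z hz => ?_⟩
    rw [sub_eq_zero.1 (hEq hz)]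
    simp only [H]
    rw [norm_mul, norm_real, Real.norm_of_nonneg (inv_pos.2 hδ).le]
    refine mul_le_mul_of_nonneg_left ?_ (inv_pos.2 hδ).le
    refine (norm_integral_mul_gaussian_le hb hM z).trans ?_
    have h2 : z.im ^ 2 ≤ β ^ 2 := by nlinarith [hz.1, hz.2]
    gcongr
  have hlim := hφ.tendsto_gaussianAverage (k⁻¹ • b)
  rw [← hk, smul_inv_smul₀ hk0] at hlim
  exact SatisfiesKMS.of_tendsto hβ (fun n => hsmooth (k⁻¹ • b) _ (by positivity))
    tendsto_const_nhds hlim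

end Dynamics

/-! ### Norm domination between `*`-homomorphisms -/

section Domination

variable {X E E' : Type*} [NonUnitalRing X] [StarRing X] [Module ℂ X]
  [NonUnitalCStarAlgebra E] [NonUnitalCStarAlgebra E']

/-- The norm closure of `{(f x, g x) | x}` as a C*-subalgebra of the product. -/
def closedGraph (f : X →⋆ₙₐ[ℂ] E) (g : X →⋆ₙₐ[ℂ] E') : NonUnitalStarSubalgebra ℂ (E × E') :=
  (NonUnitalStarAlgHom.range (f.prod g)).topologicalClosure

instance isClosed_closedGraph (f : X →⋆ₙₐ[ℂ] E) (g : X →⋆ₙₐ[ℂ] E') :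
    IsClosed (closedGraph f g : Set (E × E')) :=
  NonUnitalStarSubalgebra.isClosed_topologicalClosure _

theorem mk_mem_closedGraph (f : X →⋆ₙₐ[ℂ] E) (g : X →⋆ₙₐ[ℂ] E') (x : X) :
    (f x, g x) ∈ closedGraph f g :=
  NonUnitalStarSubalgebra.le_topologicalClosure _ (Set.mem_range_self (f := f.prod g) x)

theorem closedGraph_induction (f : X →⋆ₙₐ[ℂ] E) (g : X →⋆ₙₐ[ℂ] E') {p : E × E' → Prop}
    (hp : IsClosed {q | p q}) (h : ∀ x, p (f x, g x)) : ∀ q ∈ closedGraph f g, p q := by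
  intro q hq
  refine closure_minimal (s := Set.range (f.prod g)) ?_ hp hq
  rintro _ ⟨x, rfl⟩
  exact h x

/-- The first projection from the closed graph. -/
def closedGraphFst (f : X →⋆ₙₐ[ℂ] E) (g : X →⋆ₙₐ[ℂ] E') : closedGraph f g →⋆ₙₐ[ℂ] E :=
  (NonUnitalStarAlgHom.fst ℂ E E').comp (NonUnitalStarSubalgebraClass.subtype (closedGraph f g))

/-- The second projection from the closed graph. -/
def closedGraphSnd (f : X →⋆ₙₐ[ℂ] E) (g : X →⋆ₙₐ[ℂ] E') : closedGraph f g →⋆ₙₐ[ℂ] E' :=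
  (NonUnitalStarAlgHom.snd ℂ E E').comp (NonUnitalStarSubalgebraClass.subtype (closedGraph f g))

/-- A `*`-homomorphism `g` is dominated in norm by `f` as soon as this holds after applying a
separating family of continuous linear maps. -/
theorem norm_le_of_separating {ι P P' : Type*} [NormedAddCommGroup P] [NormedSpace ℂ P]
    [NormedAddCommGroup P'] [NormedSpace ℂ P'] (f : X →⋆ₙₐ[ℂ] E) (g : X →⋆ₙₐ[ℂ] E')
    (s : ι → E →L[ℂ] P) (s' : ι → E' →L[ℂ] P') (h : ∀ i x, ‖s' i (g x)‖ ≤ ‖s i (f x)‖)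
    (hs' : ∀ T, (∀ i, s' i T = 0) → T = 0) (x : X) : ‖g x‖ ≤ ‖f x‖ := by
  -- On the closed graph the separated inequalities persist, so a zero first coordinate forces a
  -- zero second one. The first projection is then isometric, and the maximum norm of the pair
  -- equals the norm of `f x`.
  have hinj : Function.Injective (closedGraphFst f g) := by
    rw [injective_iff_map_eq_zero]
    rintro ⟨⟨T, T'⟩, hT⟩ (h0 : T = 0)
    have hle : ∀ i, ‖s' i T'‖ ≤ ‖s i T‖ := fun i =>
      closedGraph_induction f g (p := fun q => ‖s' i q.2‖ ≤ ‖s i q.1‖)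
        (isClosed_le (by fun_prop) (by fun_prop)) (h i) _ hT
    have hT' : T' = 0 := hs' T' fun i => by simpa [h0] using hle i
    ext1
    exact Prod.ext h0 hT'
  have h1 := NonUnitalStarAlgHom.norm_map _ hinj ⟨_, mk_mem_closedGraph f g x⟩
  change ‖f x‖ = ‖(f x, g x)‖ at h1
  rw [h1]
  exact norm_snd_le (f x, g x)

/-- If `g` is dominated in norm by `f` then `f x ↦ g x` extends to a `*`-homomorphism on the norm
closure of the range of `f`. -/
theorem exists_starHom_closure_range (f : X →⋆ₙₐ[ℂ] E) (g : X →⋆ₙₐ[ℂ] E')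
    (h : ∀ x, ‖g x‖ ≤ ‖f x‖) :
    ∃ Ψ : (NonUnitalStarAlgHom.range f).topologicalClosure →⋆ₙₐ[ℂ] E',
      ∀ (x : X) (hx : f x ∈ (NonUnitalStarAlgHom.range f).topologicalClosure),
        Ψ ⟨f x, hx⟩ = g x := by
  have hle : ∀ q ∈ closedGraph f g, ‖q.2‖ ≤ ‖q.1‖ :=
    closedGraph_induction f g (isClosed_le (by fun_prop) (by fun_prop)) h
  have hiso : Isometry (closedGraphFst f g) := by
    refine NonUnitalStarAlgHom.isometry _ ((injective_iff_map_eq_zero _).2 ?_)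
    rintro ⟨⟨T, T'⟩, hT⟩ (h0 : T = 0)
    have hT' : T' = 0 := by simpa [h0] using hle _ hT
    ext1
    exact Prod.ext h0 hT'
  -- The isometric image of a complete space is closed, so the first projection reaches the entire
  -- closure of the range of `f`.
  have hrange : (Set.range (closedGraphFst f g)) =
      ((NonUnitalStarAlgHom.range f).topologicalClosure : Set E) := by
    apply Set.Subset.antisymm
    · rintro _ ⟨⟨q, hq⟩, rfl⟩
      refine closedGraph_induction f g
        (p := fun q => q.1 ∈ (NonUnitalStarAlgHom.range f).topologicalClosure) ?_ (fun x => ?_) q hq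
      · exact (NonUnitalStarSubalgebra.isClosed_topologicalClosure _).preimage continuous_fst
      · exact NonUnitalStarSubalgebra.le_topologicalClosure _ (Set.mem_range_self x)
    · refine closure_minimal ?_ hiso.isClosedEmbedding.isClosed_range
      rintro _ ⟨x, rfl⟩
      exact ⟨⟨_, mk_mem_closedGraph f g x⟩, rfl⟩
  let p : closedGraph f g →⋆ₙₐ[ℂ] (NonUnitalStarAlgHom.range f).topologicalClosure :=
    NonUnitalStarAlgHom.codRestrict (closedGraphFst f g) _
      fun q => by rw [← SetLike.mem_coe, ← hrange]; exact Set.mem_range_self q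
  have hp : Function.Bijective p := by
    refine ⟨(NonUnitalStarAlgHom.injective_codRestrict _ _ _).2 hiso.injective, ?_⟩
    rintro ⟨y, hy⟩
    rw [← SetLike.mem_coe, ← hrange] at hy
    obtain ⟨q, hq⟩ := hy
    exact ⟨q, Subtype.ext hq⟩
  let e := StarAlgEquiv.ofBijective p hp
  -- The closed graph is the graph of the extension: invert the first projection, then apply the
  -- second.
  refine ⟨(closedGraphSnd f g).comp (e.symm : _ →⋆ₙₐ[ℂ] closedGraph f g), fun x hx => ?_⟩
  have he : e.symm ⟨f x, hx⟩ = ⟨_, mk_mem_closedGraph f g x⟩ := by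
    rw [StarAlgEquiv.symm_apply_eq]
    rfl
  change closedGraphSnd f g (e.symm ⟨f x, hx⟩) = g x
  rw [he]
  rfl

end Domination

/-! ### Compressions of operators on a Hilbert tensor product -/

section Slices

variable {H K : Type*} [NormedAddCommGroup H] [InnerProductSpace ℂ H]
  [NormedAddCommGroup K] [InnerProductSpace ℂ K]

variable (H) in
/-- The bounded operator `x ↦ x ⊗ k`. -/
noncomputable def tensorRight (k : K) : H →L[ℂ] HilbertTensor H K :=
  (toHilbertTensor H K).toContinuousLinearMap.comp <|
    (TensorProduct.mkL ℂ H K).flip k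

variable (K) in
/-- The bounded operator `y ↦ h ⊗ y`. -/
noncomputable def tensorLeft (h : H) : K →L[ℂ] HilbertTensor H K :=
  (toHilbertTensor H K).toContinuousLinearMap.comp <|
    TensorProduct.mkL ℂ H K h

theorem tensorRight_apply (h : H) (k : K) :
    tensorRight H k h = toHilbertTensor H K (h ⊗ₜ k) := rfl

theorem tensorLeft_apply (h : H) (k : K) :
    tensorLeft K h k = toHilbertTensor H K (h ⊗ₜ k) := rfl

theorem opTensor_tmul (T : H →L[ℂ] H) (S : K →L[ℂ] K) (h : H) (k : K) :
    opTensor T S (toHilbertTensor H K (h ⊗ₜ k)) = toHilbertTensor H K (T h ⊗ₜ S k) := by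
  rw [opTensor_apply, TensorProduct.mapL_tmul]

theorem inner_toHilbertTensor_tmul (h h' : H) (k k' : K) :
    inner ℂ (toHilbertTensor H K (h ⊗ₜ k)) (toHilbertTensor H K (h' ⊗ₜ k')) =
      inner ℂ h h' * inner ℂ k k' := by
  rw [LinearIsometry.inner_map_map, TensorProduct.inner_tmul]

/-- An operator on the Hilbert space tensor product vanishes if its matrix coefficients between
elementary tensors do. -/
theorem hilbertTensor_clm_eq_zero {T : HilbertTensor H K →L[ℂ] HilbertTensor H K}
    (hT : ∀ (h h' : H) (k k' : K),
      inner ℂ (toHilbertTensor H K (h ⊗ₜ k)) (T (toHilbertTensor H K (h' ⊗ₜ k'))) = 0) :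
    T = 0 := by
  refine hilbertTensor_clm_ext fun x => ?_
  rw [zero_apply]
  refine (denseRange_toHilbertTensor H K).eq_zero_of_inner_right ℂ ?_
  intro y
  induction x with
  | zero => simp
  | add x₁ x₂ h₁ h₂ => rw [map_add, map_add, inner_add_right, h₁, h₂, add_zero]
  | tmul h' k' =>
    induction y with
    | zero => simp
    | add y₁ y₂ h₁ h₂ => rw [map_add, inner_add_left, h₁, h₂, add_zero]
    | tmul h k => exact hT h h' k k'

variable {L M : Type*} [NormedAddCommGroup L] [InnerProductSpace ℂ L] [CompleteSpace L]
  [NormedAddCommGroup M] [InnerProductSpace ℂ M] [CompleteSpace M]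

/-- The compression `T ↦ V* T W`. -/
noncomputable def compression (V W : L →L[ℂ] M) : (M →L[ℂ] M) →L[ℂ] (L →L[ℂ] L) :=
  (ContinuousLinearMap.compL ℂ L M L (ContinuousLinearMap.adjoint V)).comp
    ((ContinuousLinearMap.compL ℂ L M M).flip W)

theorem inner_compression (V W : L →L[ℂ] M) (T : M →L[ℂ] M) (x y : L) :
    inner ℂ x (compression V W T y) = inner ℂ (V x) (T (W y)) := by
  simp [compression, ContinuousLinearMap.adjoint_inner_right]

theorem compression_tensorRight_opTensor [CompleteSpace H] (k k' : K) (T : H →L[ℂ] H) (S : K →L[ℂ] K) :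
    compression (tensorRight H k) (tensorRight H k') (opTensor T S) = inner ℂ k (S k') • T := by
  refine ContinuousLinearMap.ext fun y => ext_inner_left ℂ fun x => ?_
  rw [inner_compression, tensorRight_apply, tensorRight_apply, opTensor_tmul,
    inner_toHilbertTensor_tmul, smul_apply, inner_smul_right, mul_comm]

theorem compression_tensorLeft_opTensor [CompleteSpace K] (h h' : H) (T : H →L[ℂ] H) (S : K →L[ℂ] K) :
    compression (tensorLeft K h) (tensorLeft K h') (opTensor T S) = inner ℂ h (T h') • S := by
  refine ContinuousLinearMap.ext fun y => ext_inner_left ℂ fun x => ?_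
  rw [inner_compression, tensorLeft_apply, tensorLeft_apply, opTensor_tmul,
    inner_toHilbertTensor_tmul, smul_apply, inner_smul_right]

end Slices

/-! ### The spatial norm and extension of representations -/

section Independence

variable {A B HA HB KA KB : Type*} [NonUnitalCStarAlgebra A] [NonUnitalCStarAlgebra B]
  [NormedAddCommGroup HA] [InnerProductSpace ℂ HA] [CompleteSpace HA]
  [NormedAddCommGroup HB] [InnerProductSpace ℂ HB] [CompleteSpace HB]
  [NormedAddCommGroup KA] [InnerProductSpace ℂ KA] [CompleteSpace KA]
  [NormedAddCommGroup KB] [InnerProductSpace ℂ KB] [CompleteSpace KB]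

/-- The slice map `a ⊗ b ↦ ℓ b • a`. -/
noncomputable def sliceRight (A : Type*) [NonUnitalCStarAlgebra A] (ℓ : B →ₗ[ℂ] ℂ) : A ⊗[ℂ] B →ₗ[ℂ] A :=
  (TensorProduct.rid ℂ A).toLinearMap ∘ₗ ℓ.lTensor A

/-- The slice map `a ⊗ b ↦ ℓ a • b`. -/
noncomputable def sliceLeft (B : Type*) [NonUnitalCStarAlgebra B] (ℓ : A →ₗ[ℂ] ℂ) : A ⊗[ℂ] B →ₗ[ℂ] B :=
  (TensorProduct.lid ℂ B).toLinearMap ∘ₗ ℓ.rTensor B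

/-- The matrix coefficient `a ↦ ⟪x, π a y⟫`. -/
noncomputable def matrixCoeff (π : A →⋆ₙₐ[ℂ] (HA →L[ℂ] HA)) (x y : HA) : A →ₗ[ℂ] ℂ where
  toFun a := inner ℂ x (π a y)
  map_add' a b := by rw [map_add, add_apply, inner_add_right]
  map_smul' c a := by rw [map_smul, smul_apply, inner_smul_right]; rfl

theorem repTensor_tmul (πA : A →⋆ₙₐ[ℂ] (HA →L[ℂ] HA)) (πB : B →⋆ₙₐ[ℂ] (HB →L[ℂ] HB))
    (a : A) (b : B) : repTensor πA πB (a ⊗ₜ b) = opTensor (πA a) (πB b) := rfl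

/-- The sliced element of `A` depends on `πB` and the two vectors but not on `πA`, so different
representations of `A` can be compared slice by slice. -/
theorem compression_tensorRight_repTensor (πA : A →⋆ₙₐ[ℂ] (HA →L[ℂ] HA))
    (πB : B →⋆ₙₐ[ℂ] (HB →L[ℂ] HB)) (k k' : HB) (x : A ⊗[ℂ] B) :
    compression (tensorRight HA k) (tensorRight HA k') (repTensor πA πB x) =
      πA (sliceRight A (matrixCoeff πB k k') x) := by
  induction x with
  | zero => simp
  | add x₁ x₂ h₁ h₂ => simp only [map_add, h₁, h₂]
  | tmul a b =>
    rw [repTensor_tmul, compression_tensorRight_opTensor]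
    simp [sliceRight, matrixCoeff]

theorem compression_tensorLeft_repTensor (πA : A →⋆ₙₐ[ℂ] (HA →L[ℂ] HA))
    (πB : B →⋆ₙₐ[ℂ] (HB →L[ℂ] HB)) (h h' : HA) (x : A ⊗[ℂ] B) :
    compression (tensorLeft HB h) (tensorLeft HB h') (repTensor πA πB x) =
      πB (sliceLeft B (matrixCoeff πA h h') x) := by
  induction x with
  | zero => simp
  | add x₁ x₂ h₁ h₂ => simp only [map_add, h₁, h₂]
  | tmul a b =>
    rw [repTensor_tmul, compression_tensorLeft_opTensor]
    simp [sliceLeft, matrixCoeff]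

/-- Both compressions are images of one element of `A`: `πA` preserves its norm by injectivity and
`ρA` does not increase it. Compressions separate operators because matrix coefficients on elementary
tensors do. -/
theorem norm_repTensor_le_left {πA : A →⋆ₙₐ[ℂ] (HA →L[ℂ] HA)} (hπA : Function.Injective πA)
    (ρA : A →⋆ₙₐ[ℂ] (KA →L[ℂ] KA)) (πB : B →⋆ₙₐ[ℂ] (HB →L[ℂ] HB)) (x : A ⊗[ℂ] B) :
    ‖repTensor ρA πB x‖ ≤ ‖repTensor πA πB x‖ := by
  refine norm_le_of_separating (repTensor πA πB) (repTensor ρA πB)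
    (fun i : HB × HB => compression (tensorRight HA i.1) (tensorRight HA i.2))
    (fun i : HB × HB => compression (tensorRight KA i.1) (tensorRight KA i.2))
    (fun i x => ?_) (fun T hT => ?_) x
  · rw [compression_tensorRight_repTensor, compression_tensorRight_repTensor,
      NonUnitalStarAlgHom.norm_map πA hπA]
    exact NonUnitalStarAlgHom.norm_apply_le ρA _
  · refine hilbertTensor_clm_eq_zero fun h h' k k' => ?_
    rw [← tensorRight_apply, ← tensorRight_apply, ← inner_compression, hT (k, k'), zero_apply,
      inner_zero_right]

theorem norm_repTensor_le_right (πA : A →⋆ₙₐ[ℂ] (HA →L[ℂ] HA)) {πB : B →⋆ₙₐ[ℂ] (HB →L[ℂ] HB)}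
    (hπB : Function.Injective πB) (ρB : B →⋆ₙₐ[ℂ] (KB →L[ℂ] KB)) (x : A ⊗[ℂ] B) :
    ‖repTensor πA ρB x‖ ≤ ‖repTensor πA πB x‖ := by
  refine norm_le_of_separating (repTensor πA πB) (repTensor πA ρB)
    (fun i : HA × HA => compression (tensorLeft HB i.1) (tensorLeft HB i.2))
    (fun i : HA × HA => compression (tensorLeft KB i.1) (tensorLeft KB i.2))
    (fun i x => ?_) (fun T hT => ?_) x
  · rw [compression_tensorLeft_repTensor, compression_tensorLeft_repTensor,
      NonUnitalStarAlgHom.norm_map πB hπB]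
    exact NonUnitalStarAlgHom.norm_apply_le ρB _
  · refine hilbertTensor_clm_eq_zero fun h h' k k' => ?_
    rw [← tensorLeft_apply, ← tensorLeft_apply, ← inner_compression, hT (h, h'), zero_apply,
      inner_zero_right]

/-- Faithful representations give the largest spatial norm. -/
theorem norm_repTensor_le {πA : A →⋆ₙₐ[ℂ] (HA →L[ℂ] HA)} (hπA : Function.Injective πA)
    {πB : B →⋆ₙₐ[ℂ] (HB →L[ℂ] HB)} (hπB : Function.Injective πB)
    (ρA : A →⋆ₙₐ[ℂ] (KA →L[ℂ] KA)) (ρB : B →⋆ₙₐ[ℂ] (KB →L[ℂ] KB)) (x : A ⊗[ℂ] B) :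
    ‖repTensor ρA ρB x‖ ≤ ‖repTensor πA πB x‖ :=
  (norm_repTensor_le_left hπA ρA ρB x).trans (norm_repTensor_le_right πA hπB ρB x)

/-- The tensor product of two representations extends to the injective tensor product. -/
theorem exists_starHom_injTensor {πA : A →⋆ₙₐ[ℂ] (HA →L[ℂ] HA)} (hπA : Function.Injective πA)
    {πB : B →⋆ₙₐ[ℂ] (HB →L[ℂ] HB)} (hπB : Function.Injective πB)
    (ρA : A →⋆ₙₐ[ℂ] (KA →L[ℂ] KA)) (ρB : B →⋆ₙₐ[ℂ] (KB →L[ℂ] KB)) :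
    ∃ Ψ : injTensor πA πB →⋆ₙₐ[ℂ] (HilbertTensor KA KB →L[ℂ] HilbertTensor KA KB),
      ∀ a b, Ψ (injTmul πA πB a b) = opTensor (ρA a) (ρB b) := by
  obtain ⟨Ψ, hΨ⟩ := exists_starHom_closure_range (repTensor πA πB) (repTensor ρA ρB)
    (norm_repTensor_le hπA hπB ρA ρB)
  exact ⟨Ψ, fun a b => hΨ (a ⊗ₜ b) _⟩

/-- Induction principle for closed properties of elements of the injective tensor product. -/
theorem injTensor_induction {πA : A →⋆ₙₐ[ℂ] (HA →L[ℂ] HA)} {πB : B →⋆ₙₐ[ℂ] (HB →L[ℂ] HB)}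
    {p : injTensor πA πB → Prop} (hp : IsClosed {x | p x}) (zero : p 0)
    (add : ∀ x y, p x → p y → p (x + y)) (tmul : ∀ a b, p (injTmul πA πB a b)) (x) : p x := by
  have hmem : ∀ y : A ⊗[ℂ] B, repTensor πA πB y ∈ injTensor πA πB := fun y =>
    NonUnitalStarSubalgebra.le_topologicalClosure _ (Set.mem_range_self (f := repTensor πA πB) y)
  have halg : ∀ y : A ⊗[ℂ] B, p ⟨repTensor πA πB y, hmem y⟩ := by
    intro y
    induction y with
    | zero => convert zero; simp
    | add y₁ y₂ h₁ h₂ => convert add _ _ h₁ h₂; simp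
    | tmul a b => exact tmul a b
  have hcl : x ∈ closure (Set.range fun y => (⟨repTensor πA πB y, hmem y⟩ : injTensor πA πB)) := by
    rw [closure_subtype, ← Set.range_comp]
    exact x.2
  refine closure_minimal ?_ hp hcl
  rintro _ ⟨y, rfl⟩
  exact halg y

end Independence

/-! ### GNS vectors without a unit -/

section GNSRepresentation

open Filter Topology UniformSpace

namespace PositiveLinearMap

variable {A : Type*} [NonUnitalCStarAlgebra A] [PartialOrder A] [StarOrderedRing A]
  (f : A →ₚ[ℂ] ℂ)

/-- The canonical map of `A` into the GNS space. -/
noncomputable def toGNS : A →ₗ[ℂ] f.GNS :=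
  (Completion.toComplₗᵢ (𝕜 := ℂ) (E := f.PreGNS)).toLinearMap ∘ₗ f.toPreGNS.toLinearMap

theorem toGNS_apply (a : A) : f.toGNS a = ((f.toPreGNS a : f.PreGNS) : f.GNS) := rfl

theorem denseRange_toGNS : DenseRange f.toGNS :=
  Completion.denseRange_coe.comp f.toPreGNS.surjective.denseRange
    (Completion.continuous_coe f.PreGNS)

theorem inner_toGNS (a b : A) : inner ℂ (f.toGNS a) (f.toGNS b) = f (star a * b) := by
  rw [toGNS_apply, toGNS_apply, Completion.inner_coe, preGNS_inner_def, ofPreGNS_toPreGNS,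
    ofPreGNS_toPreGNS]

theorem gns_toGNS (a b : A) : f.gnsNonUnitalStarAlgHom a (f.toGNS b) = f.toGNS (a * b) := by
  rw [toGNS_apply, gnsNonUnitalStarAlgHom_apply_coe]
  rfl

/-- An approximate unit stands in for the missing unit: apply Cauchy–Schwarz to `f (e * a)`, viewed
as the inner product of the classes of `e` and `a`, and pass to the limit. -/
theorem norm_apply_le_sqrt_mul_norm_toGNS {C : ℝ} (hC0 : 0 ≤ C) (hC : ∀ a, ‖f a‖ ≤ C * ‖a‖) (a : A) :
    ‖f a‖ ≤ √C * ‖f.toGNS a‖ := by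
  have hlim := (CStarAlgebra.increasingApproximateUnit A).tendsto_mul_right a
  have hf : Continuous f := AddMonoidHomClass.continuous_of_bound f C hC
  have := (CStarAlgebra.increasingApproximateUnit A).neBot
  refine le_of_tendsto ((hf.tendsto a).comp hlim).norm ?_
  filter_upwards [(CStarAlgebra.increasingApproximateUnit A).eventually_star_eq,
    (CStarAlgebra.increasingApproximateUnit A).eventually_norm] with e he hn
  have h1 : f (e * a) = inner ℂ (f.toGNS e) (f.toGNS a) := by rw [inner_toGNS, he]
  have h2 : ‖f.toGNS e‖ ≤ √C := by
    apply Real.le_sqrt_of_sq_le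
    have h3 : ‖f.toGNS e‖ ^ 2 = ‖f (star e * e)‖ := by
      rw [← inner_toGNS, inner_self_eq_norm_sq_to_K]
      simp
    rw [h3]
    refine (hC _).trans ?_
    rw [CStarRing.norm_star_mul_self]
    nlinarith [norm_nonneg e, mul_le_one₀ hn (norm_nonneg e) hn]
  change ‖f (e * a)‖ ≤ _
  rw [h1]
  exact (norm_inner_le_norm _ _).trans (mul_le_mul_of_nonneg_right h2 (norm_nonneg _))

/-- The vector of the GNS space that represents the functional. -/
theorem exists_gns_vector {C : ℝ} (hC0 : 0 ≤ C) (hC : ∀ a, ‖f a‖ ≤ C * ‖a‖) :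
    ∃ Ω : f.GNS, (∀ a, f a = inner ℂ Ω (f.gnsNonUnitalStarAlgHom a Ω)) ∧ ‖Ω‖ ^ 2 ≤ C := by
  have hbound : ∀ a, ‖f.toLinearMap a‖ ≤ √C * ‖f.toGNS a‖ :=
    f.norm_apply_le_sqrt_mul_norm_toGNS hC0 hC
  -- The bound lets `f` descend to the GNS space as a bounded functional; its Riesz vector is `Ω`.
  set ℓ : f.GNS →L[ℂ] ℂ := f.toLinearMap.extendOfNorm f.toGNS with hℓ
  set Ω : f.GNS := (InnerProductSpace.toDual ℂ f.GNS).symm ℓ with hΩ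
  have hin : ∀ a, inner ℂ Ω (f.toGNS a) = f a := fun a => by
    rw [hΩ, InnerProductSpace.toDual_symm_apply, hℓ,
      LinearMap.extendOfNorm_eq f.denseRange_toGNS ⟨_, hbound⟩]
    rfl
  have hcyc : ∀ a, f.gnsNonUnitalStarAlgHom a Ω = f.toGNS a := fun a => by
    refine f.denseRange_toGNS.eq_of_inner_right ℂ fun b => ?_
    rw [← ContinuousLinearMap.adjoint_inner_left, ← ContinuousLinearMap.star_eq_adjoint,
      ← map_star, gns_toGNS, inner_toGNS, ← inner_conj_symm, hin, starRingEnd_apply, ← map_star,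
      star_mul, star_star]
  refine ⟨Ω, fun a => by rw [hcyc, hin], ?_⟩
  have hn : ‖Ω‖ ≤ √C := by
    rw [hΩ, LinearIsometryEquiv.norm_map]
    exact LinearMap.opNorm_extendOfNorm_le f.denseRange_toGNS (Real.sqrt_nonneg _) hbound
  calc ‖Ω‖ ^ 2 ≤ √C ^ 2 := by gcongr
    _ = C := Real.sq_sqrt hC0

end PositiveLinearMap

/-- Every bounded positive functional on a C*-algebra is a vector functional in some representation,
with a vector of controlled norm. -/
theorem exists_representation_of_positive.{u} {A : Type u} [NonUnitalCStarAlgebra A]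
    (ω : A →L[ℂ] ℂ) (hω : ∀ a, 0 ≤ ω (star a * a)) :
    ∃ (H : Type u) (_ : NormedAddCommGroup H) (_ : InnerProductSpace ℂ H) (_ : CompleteSpace H)
      (ρ : A →⋆ₙₐ[ℂ] (H →L[ℂ] H)) (Ω : H),
      (∀ a, ω a = inner ℂ Ω (ρ a Ω)) ∧ ‖Ω‖ ^ 2 ≤ ‖ω‖ := by
  let := CStarAlgebra.spectralOrder A
  have := CStarAlgebra.spectralOrderedRing A
  let f : A →ₚ[ℂ] ℂ := PositiveLinearMap.mk₀ (ω : A →ₗ[ℂ] ℂ) fun x hx => by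
    obtain ⟨b, rfl⟩ := CStarAlgebra.nonneg_iff_eq_star_mul_self.1 hx
    exact hω b
  obtain ⟨Ω, h1, h2⟩ := f.exists_gns_vector (norm_nonneg ω) ω.le_opNorm
  exact ⟨f.GNS, inferInstance, inferInstance, inferInstance, f.gnsNonUnitalStarAlgHom, Ω, h1, h2⟩

end GNSRepresentation

/-! ### Dynamics and product states on the injective tensor product -/

section InjectiveTensor

variable {A B HA HB : Type*} [NonUnitalCStarAlgebra A] [NonUnitalCStarAlgebra B]
  [NormedAddCommGroup HA] [InnerProductSpace ℂ HA] [CompleteSpace HA]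
  [NormedAddCommGroup HB] [InnerProductSpace ℂ HB] [CompleteSpace HB]
  {πA : A →⋆ₙₐ[ℂ] (HA →L[ℂ] HA)} {πB : B →⋆ₙₐ[ℂ] (HB →L[ℂ] HB)}

theorem norm_opTensor_le {H K : Type*} [NormedAddCommGroup H] [InnerProductSpace ℂ H]
    [NormedAddCommGroup K] [InnerProductSpace ℂ K] (T : H →L[ℂ] H) (S : K →L[ℂ] K) :
    ‖opTensor T S‖ ≤ ‖T‖ * ‖S‖ := by
  refine ContinuousLinearMap.opNorm_le_bound _ (by positivity) fun x => ?_
  refine (denseRange_toHilbertTensor H K).induction_on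
    (p := fun x => ‖opTensor T S x‖ ≤ ‖T‖ * ‖S‖ * ‖x‖) x
    (isClosed_le (by fun_prop) (by fun_prop)) fun y => ?_
  rw [opTensor_apply, LinearIsometry.norm_map, LinearIsometry.norm_map]
  exact (ContinuousLinearMap.le_opNorm _ _).trans
    (mul_le_mul_of_nonneg_right (TensorProduct.norm_mapL_le T S) (norm_nonneg _))

theorem coe_injTmul (a : A) (b : B) :
    (injTmul πA πB a b : HilbertTensor HA HB →L[ℂ] HilbertTensor HA HB) =
      opTensor (πA a) (πB b) := rfl

theorem injTmul_mul (a a' : A) (b b' : B) :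
    injTmul πA πB a b * injTmul πA πB a' b' = injTmul πA πB (a * a') (b * b') := by
  apply Subtype.ext
  change opTensor (πA a) (πB b) * opTensor (πA a') (πB b') = _
  rw [coe_injTmul, ← opTensor_mul, map_mul, map_mul]

theorem norm_injTmul_le (a : A) (b : B) : ‖injTmul πA πB a b‖ ≤ ‖a‖ * ‖b‖ := by
  change ‖opTensor (πA a) (πB b)‖ ≤ _
  refine (norm_opTensor_le _ _).trans ?_
  gcongr
  · exact NonUnitalStarAlgHom.norm_apply_le πA a
  · exact NonUnitalStarAlgHom.norm_apply_le πB b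

theorem continuous_injTmul : Continuous fun p : A × B => injTmul πA πB p.1 p.2 := by
  let L : A →ₗ[ℂ] B →ₗ[ℂ] injTensor πA πB := LinearMap.mk₂ ℂ (injTmul πA πB)
    (fun a₁ a₂ b => Subtype.ext <| by
      change opTensor (πA (a₁ + a₂)) (πB b) = opTensor (πA a₁) (πB b) + opTensor (πA a₂) (πB b)
      rw [map_add, opTensor_add_left])
    (fun c a b => Subtype.ext <| by
      change opTensor (πA (c • a)) (πB b) = c • opTensor (πA a) (πB b)
      rw [map_smul, opTensor_smul_left])
    (fun a b₁ b₂ => Subtype.ext <| by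
      change opTensor (πA a) (πB (b₁ + b₂)) = opTensor (πA a) (πB b₁) + opTensor (πA a) (πB b₂)
      rw [map_add, opTensor_add_right])
    (fun c a b => Subtype.ext <| by
      change opTensor (πA a) (πB (c • b)) = c • opTensor (πA a) (πB b)
      rw [map_smul, opTensor_smul_right])
  exact (L.mkContinuous₂ 1 fun a b => by
    simpa [L] using norm_injTmul_le (πA := πA) (πB := πB) a b).continuous₂

theorem Continuous.injTmul {X : Type*} [TopologicalSpace X] {f : X → A} {g : X → B}
    (hf : Continuous f) (hg : Continuous g) : Continuous fun t => injTmul πA πB (f t) (g t) := by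
  have h := continuous_injTmul (πA := πA) (πB := πB)
  have h' := Continuous.comp h (hf.prodMk hg)
  exact h'

/-- Two `*`-homomorphisms on the injective tensor product that agree on elementary tensors are
equal. -/
theorem injTensor_hom_ext {E F : Type*} [NonUnitalCStarAlgebra E]
    [FunLike F (injTensor πA πB) E] [NonUnitalAlgHomClass F ℂ (injTensor πA πB) E]
    [StarHomClass F (injTensor πA πB) E] {Ψ Ψ' : F}
    (h : ∀ a b, Ψ (injTmul πA πB a b) = Ψ' (injTmul πA πB a b)) (x : injTensor πA πB) :
    Ψ x = Ψ' x := by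
  have hc : ∀ Θ : F, Continuous Θ := fun Θ =>
    AddMonoidHomClass.continuous_of_bound Θ 1 fun x => by
      simpa using NonUnitalStarAlgHom.norm_apply_le Θ x
  refine injTensor_induction (p := fun x => Ψ x = Ψ' x) (isClosed_eq (hc Ψ) (hc Ψ')) ?_ ?_ h x
  · rw [map_zero, map_zero]
  · intro x y hx hy
    rw [map_add, map_add, hx, hy]

/-- The twisted representations `πA ∘ α` and `πB ∘ γ` need not be faithful for the extension to
exist; density keeps its values in the closed subalgebra. -/
theorem exists_starHom_tensor (hπA : Function.Injective πA) (hπB : Function.Injective πB)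
    (α : A →⋆ₙₐ[ℂ] A) (γ : B →⋆ₙₐ[ℂ] B) :
    ∃ Ψ : injTensor πA πB →⋆ₙₐ[ℂ] injTensor πA πB,
      ∀ a b, Ψ (injTmul πA πB a b) = injTmul πA πB (α a) (γ b) := by
  obtain ⟨Ψ, hΨ⟩ := exists_starHom_injTensor hπA hπB (πA.comp α) (πB.comp γ)
  have hc : Continuous Ψ := AddMonoidHomClass.continuous_of_bound Ψ 1 fun x => by
    simpa using NonUnitalStarAlgHom.norm_apply_le Ψ x
  have hmem : ∀ x, Ψ x ∈ injTensor πA πB := by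
    intro x
    refine injTensor_induction (p := fun x => Ψ x ∈ injTensor πA πB)
      ((injTensor_isClosed πA πB).preimage hc) ?_ ?_ ?_ x
    · rw [map_zero]; exact zero_mem _
    · intro x y hx hy
      rw [map_add]; exact add_mem hx hy
    · intro a b
      rw [hΨ]
      exact (injTmul πA πB (α a) (γ b)).2
  exact ⟨NonUnitalStarAlgHom.codRestrict Ψ _ hmem, fun a b => Subtype.ext (hΨ a b)⟩

/-- The tensor product of two `*`-automorphisms extends to the injective tensor product. -/
theorem exists_starAlgEquiv_tensor (hπA : Function.Injective πA) (hπB : Function.Injective πB)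
    (α : A ≃⋆ₐ[ℂ] A) (γ : B ≃⋆ₐ[ℂ] B) :
    ∃ e : injTensor πA πB ≃⋆ₐ[ℂ] injTensor πA πB,
      ∀ a b, e (injTmul πA πB a b) = injTmul πA πB (α a) (γ b) := by
  obtain ⟨Ψ, hΨ⟩ := exists_starHom_tensor hπA hπB (α : A →⋆ₙₐ[ℂ] A) (γ : B →⋆ₙₐ[ℂ] B)
  obtain ⟨Θ, hΘ⟩ := exists_starHom_tensor hπA hπB (α.symm : A →⋆ₙₐ[ℂ] A) (γ.symm : B →⋆ₙₐ[ℂ] B)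
  have h1 : Function.LeftInverse Θ Ψ := fun x =>
    injTensor_hom_ext (Ψ := Θ.comp Ψ) (Ψ' := NonUnitalStarAlgHom.id ℂ _)
      (fun a b => by simp [hΨ, hΘ]) x
  have h2 : Function.RightInverse Θ Ψ := fun x =>
    injTensor_hom_ext (Ψ := Ψ.comp Θ) (Ψ' := NonUnitalStarAlgHom.id ℂ _)
      (fun a b => by simp [hΨ, hΘ]) x
  exact ⟨StarAlgEquiv.ofBijective Ψ ⟨h1.injective, h2.surjective⟩, fun a b => hΨ a b⟩

/-- Automorphisms are isometric, so orbits of nearby elements are uniformly close, and uniform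
limits of continuous functions are continuous. -/
theorem isClosed_setOf_continuous_orbit {C : Type*} [NonUnitalCStarAlgebra C]
    (Φ : ℝ → (C ≃⋆ₐ[ℂ] C)) : IsClosed {x | Continuous fun t => Φ t x} := by
  refine isClosed_of_closure_subset fun x hx => ?_
  refine continuous_of_uniform_approx_of_continuous fun u hu => ?_
  obtain ⟨ε, hε, hu⟩ := Metric.mem_uniformity_dist.1 hu
  obtain ⟨y, hy, hxy⟩ := Metric.mem_closure_iff.1 hx ε hε
  exact ⟨fun t => Φ t y, hy, fun t => hu (by rwa [(StarAlgEquiv.isometry (Φ t)).dist_eq])⟩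

theorem continuous_orbit_injTensor {φ : ℝ → (A ≃⋆ₐ[ℂ] A)} (hφ : IsCStarDynamics φ)
    {ϕ : ℝ → (B ≃⋆ₐ[ℂ] B)} (hϕ : IsCStarDynamics ϕ)
    {Φ : ℝ → (injTensor πA πB ≃⋆ₐ[ℂ] injTensor πA πB)}
    (hΦ : ∀ t a b, Φ t (injTmul πA πB a b) = injTmul πA πB (φ t a) (ϕ t b))
    (x : injTensor πA πB) : Continuous fun t => Φ t x := by
  refine injTensor_induction (p := fun x => Continuous fun t => Φ t x)
    (isClosed_setOf_continuous_orbit Φ) ?_ ?_ (fun a b => ?_) x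
  · exact (continuous_const (y := (0 : injTensor πA πB))).congr fun t => (map_zero (Φ t)).symm
  · intro x y hx hy
    exact (hx.add hy).congr fun t => (map_add (Φ t) x y).symm
  · exact (Continuous.injTmul (hφ.continuous a) (hϕ.continuous b)).congr
      fun t => (hΦ t a b).symm

/-- The tensor product of two C*-dynamical systems is a C*-dynamical system. -/
theorem IsCStarDynamics.tensor {φ : ℝ → (A ≃⋆ₐ[ℂ] A)} (hφ : IsCStarDynamics φ)
    {ϕ : ℝ → (B ≃⋆ₐ[ℂ] B)} (hϕ : IsCStarDynamics ϕ)
    {Φ : ℝ → (injTensor πA πB ≃⋆ₐ[ℂ] injTensor πA πB)}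
    (hΦ : ∀ t a b, Φ t (injTmul πA πB a b) = injTmul πA πB (φ t a) (ϕ t b)) :
    IsCStarDynamics Φ where
  map_zero x := injTensor_hom_ext (Ψ := Φ 0) (Ψ' := StarAlgEquiv.refl ℂ (injTensor πA πB))
    (fun a b => by rw [hΦ, hφ.map_zero, hϕ.map_zero]; rfl) x
  map_add s t x := injTensor_hom_ext (Ψ := Φ (s + t)) (Ψ' := (Φ t).trans (Φ s))
    (fun a b => by
      rw [StarAlgEquiv.trans_apply, hΦ, hΦ, hΦ, hφ.map_add, hϕ.map_add]) x
  continuous := continuous_orbit_injTensor hφ hϕ hΦ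

/-- The product of two states, as a functional on the injective tensor product. -/
theorem exists_product_state (hπA : Function.Injective πA) (hπB : Function.Injective πB)
    {ωA : A →L[ℂ] ℂ} (hA : ∀ a, 0 ≤ ωA (star a * a)) (hA1 : ‖ωA‖ = 1)
    {ωB : B →L[ℂ] ℂ} (hB : ∀ b, 0 ≤ ωB (star b * b)) (hB1 : ‖ωB‖ = 1) :
    ∃ ω : injTensor πA πB →L[ℂ] ℂ, (∀ x, 0 ≤ ω (star x * x)) ∧ ‖ω‖ = 1 ∧
      ∀ a b, ω (injTmul πA πB a b) = ωA a * ωB b := by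
  obtain ⟨KA, _, _, _, ρA, ΩA, hρA, hΩA⟩ := exists_representation_of_positive ωA hA
  obtain ⟨KB, _, _, _, ρB, ΩB, hρB, hΩB⟩ := exists_representation_of_positive ωB hB
  obtain ⟨Ψ, hΨ⟩ := exists_starHom_injTensor hπA hπB ρA ρB
  set ξ : HilbertTensor KA KB := toHilbertTensor KA KB (ΩA ⊗ₜ ΩB) with hξ
  have hξ1 : ‖ξ‖ ^ 2 ≤ 1 := by
    rw [hξ, LinearIsometry.norm_map, TensorProduct.norm_tmul, mul_pow]
    rw [hA1] at hΩA
    rw [hB1] at hΩB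
    exact mul_le_one₀ hΩA (by positivity) hΩB
  let ω₀ : injTensor πA πB →ₗ[ℂ] ℂ :=
    { toFun x := inner ℂ ξ (Ψ x ξ)
      map_add' x y := by rw [map_add, add_apply, inner_add_right]
      map_smul' c x := by rw [map_smul, smul_apply, inner_smul_right]; rfl }
  have hbound : ∀ x, ‖ω₀ x‖ ≤ 1 * ‖x‖ := fun x => by
    calc ‖ω₀ x‖ ≤ ‖ξ‖ * (‖Ψ x‖ * ‖ξ‖) := (norm_inner_le_norm _ _).trans
          (mul_le_mul_of_nonneg_left ((Ψ x).le_opNorm ξ) (norm_nonneg _))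
      _ = ‖ξ‖ ^ 2 * ‖Ψ x‖ := by ring
      _ ≤ 1 * ‖x‖ := by
        gcongr
        exact NonUnitalStarAlgHom.norm_apply_le Ψ x
  let ω : injTensor πA πB →L[ℂ] ℂ := ω₀.mkContinuous 1 hbound
  have hωx : ∀ x, ω x = inner ℂ ξ (Ψ x ξ) := fun x => rfl
  have hprod : ∀ a b, ω (injTmul πA πB a b) = ωA a * ωB b := fun a b => by
    rw [hωx, hΨ, hξ, opTensor_tmul, inner_toHilbertTensor_tmul, ← hρA, ← hρB]
  refine ⟨ω, fun x => ?_, le_antisymm (ω₀.mkContinuous_norm_le zero_le_one hbound) ?_, hprod⟩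
  · rw [hωx, map_mul, map_star, ContinuousLinearMap.star_eq_adjoint]
    change 0 ≤ inner ℂ ξ (ContinuousLinearMap.adjoint (Ψ x) (Ψ x ξ))
    rw [ContinuousLinearMap.adjoint_inner_right, inner_self_eq_norm_sq_to_K,
      ← RCLike.ofReal_pow]
    exact RCLike.ofReal_nonneg.2 (sq_nonneg _)
  -- The lower bound comes from elementary tensors: with `a` fixed, `ωA a • ωB` has norm at most
  -- `‖ω‖ * ‖a‖`, and `ωB` has norm one.
  · rw [← hA1]
    refine ωA.opNorm_le_bound ω.opNorm_nonneg fun a => ?_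
    have h1 : ‖ωA a • ωB‖ ≤ ‖ω‖ * ‖a‖ :=
      ContinuousLinearMap.opNorm_le_bound _ (by positivity) fun b => by
        rw [smul_apply, smul_eq_mul, ← hprod, mul_assoc]
        exact (ω.le_opNorm _).trans
          (mul_le_mul_of_nonneg_left (norm_injTmul_le a b) ω.opNorm_nonneg)
    rwa [norm_smul, hB1, mul_one] at h1

/-- The KMS condition passes to product functionals. -/
theorem SatisfiesKMS.tensor {β : ℝ} (hβ : 0 < β) {φ : ℝ → (A ≃⋆ₐ[ℂ] A)}
    {ϕ : ℝ → (B ≃⋆ₐ[ℂ] B)} {Φ : ℝ → (injTensor πA πB ≃⋆ₐ[ℂ] injTensor πA πB)}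
    (hΦ : ∀ t a b, Φ t (injTmul πA πB a b) = injTmul πA πB (φ t a) (ϕ t b))
    {ωA : A →L[ℂ] ℂ} {ωB : B →L[ℂ] ℂ} {ω : injTensor πA πB →L[ℂ] ℂ}
    (hω : ∀ a b, ω (injTmul πA πB a b) = ωA a * ωB b)
    (hA : ∀ a a', SatisfiesKMS β φ ωA a a') (hB : ∀ b b', SatisfiesKMS β ϕ ωB b b')
    (x y : injTensor πA πB) : SatisfiesKMS β Φ ω x y := by
  have htmul : ∀ a a' b b',
      SatisfiesKMS β Φ ω (injTmul πA πB a b) (injTmul πA πB a' b') := by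
    intro a a' b b'
    simpa only [SatisfiesKMS, hΦ, injTmul_mul, hω] using IsStripBoundary.mul (hA a a') (hB b b')
  -- Density is used one variable at a time; closedness in each is stability of bounded strip
  -- functions under norm limits.
  refine injTensor_induction (p := fun x => SatisfiesKMS β Φ ω x y) ?_ .zero_left
    (fun _ _ => .add_left) (fun a b => ?_) x
  · exact IsSeqClosed.isClosed fun xn x hxn hx => .of_tendsto hβ hxn hx tendsto_const_nhds
  refine injTensor_induction (p := fun y => SatisfiesKMS β Φ ω (injTmul πA πB a b) y) ?_
    .zero_right (fun _ _ => .add_right) (fun a' b' => htmul a a' b b') y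
  exact IsSeqClosed.isClosed fun yn y hyn hy => .of_tendsto hβ hyn tendsto_const_nhds hy

end InjectiveTensor

theorem theorem4p2 {A B HA HB : Type*} [NonUnitalCStarAlgebra A] [NonUnitalCStarAlgebra B]
    [NormedAddCommGroup HA] [InnerProductSpace ℂ HA] [CompleteSpace HA]
    [NormedAddCommGroup HB] [InnerProductSpace ℂ HB] [CompleteSpace HB]
    (πA : A →⋆ₙₐ[ℂ] (HA →L[ℂ] HA)) (hπA : Function.Injective πA)
    (πB : B →⋆ₙₐ[ℂ] (HB →L[ℂ] HB)) (hπB : Function.Injective πB)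
    (β : ℝ) (hβ : 0 < β)
    (φ : ℝ → (A ≃⋆ₐ[ℂ] A)) (hφ : IsCStarDynamics φ)
    (ϕ : ℝ → (B ≃⋆ₐ[ℂ] B)) (hϕ : IsCStarDynamics ϕ)
    (ωA : A →L[ℂ] ℂ) (hωA : IsKMSState β φ ωA)
    (ωB : B →L[ℂ] ℂ) (hωB : IsKMSState β ϕ ωB) :
    (∃ Φ : ℝ → ℝ → (injTensor πA πB ≃⋆ₐ[ℂ] injTensor πA πB),
      ∀ t s a b, Φ t s (injTmul πA πB a b) = injTmul πA πB (φ t a) (ϕ s b)) ∧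
    ∀ Φ : ℝ → ℝ → (injTensor πA πB ≃⋆ₐ[ℂ] injTensor πA πB),
      (∀ t s a b, Φ t s (injTmul πA πB a b) = injTmul πA πB (φ t a) (ϕ s b)) →
      IsCStarDynamics (fun t => Φ t t) ∧
      ∃ ω : injTensor πA πB →L[ℂ] ℂ,
        IsKMSState β (fun t => Φ t t) ω ∧
        ∀ a b, ω (injTmul πA πB a b) = ωA a * ωB b := by
  refine ⟨?_, fun Φ hΦ => ?_⟩
  · choose Φ hΦ using fun t s => exists_starAlgEquiv_tensor hπA hπB (φ t) (ϕ s)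
    exact ⟨Φ, hΦ⟩
  have hΦd : ∀ t a b, Φ t t (injTmul πA πB a b) = injTmul πA πB (φ t a) (ϕ t b) :=
    fun t => hΦ t t
  refine ⟨hφ.tensor hϕ hΦd, ?_⟩
  obtain ⟨ω, hpos, hnorm, hprod⟩ := exists_product_state hπA hπB hωA.nonneg hωA.norm_eq_one
    hωB.nonneg hωB.norm_eq_one
  refine ⟨ω, ⟨hpos, hnorm, fun x y => ?_⟩, hprod⟩
  obtain ⟨F, hd, hc, -, hF⟩ := SatisfiesKMS.tensor hβ hΦd hprod (hωA.satisfiesKMS hβ hφ)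
    (hωB.satisfiesKMS hβ hϕ) x y
  exact ⟨F, hd, hc, hF⟩
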